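/- Let $(X,\mathcal B,m)$ be a localizable measure space: every $A\in\mathcal B$ with $m(A)=\infty$ contains some $A'\in\mathcal B$ with $0<m(A')<\infty$, and every $\mathcal A\subseteq\mathcal B$ has an essential supremum, i.e. there is $S\in\mathcal B$ with $m(A\setminus S)=0$ for all $A\in\mathcal A$, such that $m(S\setminus G)=0$ for every $G\in\mathcal B$ with $m(A\setminus G)=0$ for all $A\in\mathcal A$. Let $L^0(m)$ be the space of $m$-a.e. classes of real-valued measurable functions with the topology $\tau(m)$ of local convergence in measure, generated by the balls of the pseudometrics $d_U(f,g)=\int_U |f-g|\wedge 1\,dm$, $U\in\mathcal B$, $m(U)<\infty$. A quadratic form on a real vector space $V$ is a map $q:V\to[0,\infty]$ with $2q(u)+2q(v)=q(u-v)+q(u+v)$ and $q(\lambda u)=|\lambda|^2q(u)$ (where $0\cdot\infty=0$); its domain is $D(q)=\{q<\infty\}$. Given a vector space topology $\tau$ on $V$, $q$ is closed if $D(q)$ is complete in the smallest topology containing the subspace topology of $\tau$ and the topology of the seminorm $q^{1/2}$; a form $q'$ extends $q$ if $D(q)\subseteq D(q')$ and $q'=q$ on $D(q)$; $q$ is closable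 if it has a closed extension. A Dirichlet form on $L^2(m)$ is a quadratic form $\mathcal E$ on $L^2(m)$, closed with respect to the norm topology (and not necessarily densely defined), such that for every $\varepsilon>0$ there is a monotone increasing 1-Lipschitz function $C_\varepsilon:\mathbb R\to[-\varepsilon,1+\varepsilon]$ with $C_\varepsilon(x)=x$ for $x\in[0,1]$ and $\mathcal E(C_\varepsilon\circ u)\le\mathcal E(u)$ for all $u\in L^2(m)$. It is regarded as a quadratic form on $L^0(m)$ by setting $\mathcal E=\infty$ on $L^0(m)\setminus L^2(m)$. **Theorem.** Let $m$ be localizable and let $\mathcal E$ be a Dirichlet form on $L^2(m)$. Then $\mathcal E$ is closable on $(L^0(m),\tau(m))$. Moreover, there is exactly one quadratic form $\mathcal E_{\rm e}$ on $L^0(m)$ (the closure of $\mathcal E$ on $L^0(m)$, called the extended Dirichlet form of $\mathcal E$) such that $\mathcal E_{\rm e}(f)=\lim_i\mathcal E(f_i)$ whenever $(f_i)$ is an $\mathcal E$-Cauchy net in $D(\mathcal E)$ that $\tau(m)$-converges to $f$, and $\mathcal E_{\rm e}(f)=\infty$ if there is no such net. The form $\mathcal E_{\rm e}$ is closed on $(L^0(m),\tau(m))$,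 it extends $\mathcal E$, and every closed quadratic form on $(L^0(m),\tau(m))$ that extends $\mathcal E$ is an extension of $\mathcal E_{\rm e}$. -/

import Mathlib

open MeasureTheory Filter Topology
open scoped ENNReal

noncomputable section

namespace FormTheory

/-! ### Quadratic forms on real vector spaces -/

/-- A (positive) quadratic form on a real vector space `V`, with values in `[0, ∞]`. -/
structure QForm (V : Type*) [AddCommGroup V] [Module ℝ V] where
  toFun : V → ℝ≥0∞
  parallelogram' : ∀ u v : V, 2 * toFun u + 2 * toFun v = toFun (u - v) + toFun (u + v)
  homogeneous' : ∀ (c : ℝ) (u : V), toFun (c • u) = ENNReal.ofReal (|c| ^ 2) * toFun u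

namespace QForm

variable {V : Type*} [AddCommGroup V] [Module ℝ V]

instance : CoeFun (QForm V) (fun _ => V → ℝ≥0∞) := ⟨QForm.toFun⟩

theorem map_zero (q : QForm V) : q 0 = 0 := by
  simpa using q.homogeneous' 0 0

theorem map_add_lt_top (q : QForm V) {u v : V} (hu : q u < ∞) (hv : q v < ∞) :
    q (u + v) < ∞ := by
  have h := q.parallelogram' u v
  have h1 : 2 * q u + 2 * q v < ∞ :=
    ENNReal.add_lt_top.2 ⟨ENNReal.mul_lt_top (by simp) hu, ENNReal.mul_lt_top (by simp) hv⟩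
  rw [h] at h1
  exact (ENNReal.add_lt_top.1 h1).2

/-- The domain `D(q) = {u | q u < ∞}`. -/
def domain (q : QForm V) : Submodule ℝ V where
  carrier := {u | q u < ∞}
  add_mem' := fun hu hv => q.map_add_lt_top hu hv
  zero_mem' := by
    change q 0 < ∞
    rw [q.map_zero]
    exact ENNReal.zero_lt_top
  smul_mem' := fun c u hu => by
    change q (c • u) < ∞
    rw [q.homogeneous' c u]
    exact ENNReal.mul_lt_top ENNReal.ofReal_lt_top hu

/-- The form seminorm `‖u‖_q = q(u)^{1/2}` on the domain of `q`. -/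
def formSeminorm (q : QForm V) (u : q.domain) : ℝ := √(q (u : V)).toReal

/-- The topology on `D(q)` generated by the form seminorm, i.e. by its open balls. -/
@[reducible]
def formSeminormTopology (q : QForm V) : TopologicalSpace q.domain :=
  TopologicalSpace.generateFrom
    {B | ∃ (u : q.domain) (r : ℝ), 0 < r ∧ B = {v | q.formSeminorm (v - u) < r}}

/-- The form topology `τ_q`: the smallest topology on `D(q)` that contains the subspace topology
of `τ` and the topology of the form seminorm. (In Mathlib's order on topologies, this is the
infimum.) -/
@[reducible]
def formTopology (τ : TopologicalSpace V) (q : QForm V) : TopologicalSpace q.domain :=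
  TopologicalSpace.induced (fun u : q.domain => (u : V)) τ ⊓ q.formSeminormTopology

end QForm

/-- Completeness of a vector space topology with respect to its translation invariant uniform
structure (generated by the sets `{(u, v) | u - v ∈ U}`, `U` a neighbourhood of `0`): every Cauchy
filter, equivalently every Cauchy net, converges. -/
def IsCompleteVectorTopology {W : Type*} [AddCommGroup W] (τ : TopologicalSpace W) : Prop :=
  ∀ F : Filter W, F.NeBot →
    Tendsto (fun p : W × W => p.1 - p.2) (F ×ˢ F) (@nhds W τ 0) → ∃ x : W, F ≤ @nhds W τ x

namespace QForm

variable {V : Type*} [AddCommGroup V] [Module ℝ V]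

/-- `q` is closed with respect to `τ`: its domain is complete in the form topology. -/
def IsClosedForm (τ : TopologicalSpace V) (q : QForm V) : Prop :=
  IsCompleteVectorTopology (q.formTopology τ)

/-- `q'` is an extension of `q`. -/
def IsExtension (q q' : QForm V) : Prop :=
  q.domain ≤ q'.domain ∧ ∀ u ∈ q.domain, q' u = q u

/-- `q` is closable with respect to `τ`: it possesses a closed extension. -/
def IsClosable (τ : TopologicalSpace V) (q : QForm V) : Prop :=
  ∃ q' : QForm V, q.IsExtension q' ∧ q'.IsClosedForm τ

/-- The filter `F` lives on `D(q)`, is `q`-Cauchy and `τ`-converges to `u`; such filters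
correspond to the `q`-Cauchy nets in `D(q)` that `τ`-converge to `u`. -/
structure IsApproximation (τ : TopologicalSpace V) (q : QForm V) (u : V) (F : Filter V) :
    Prop where
  neBot : F.NeBot
  domain_mem : (q.domain : Set V) ∈ F
  cauchy : Tendsto (fun p : V × V => q (p.1 - p.2)) (F ×ˢ F) (𝓝 0)
  tendsto : F ≤ @nhds V τ u

/-- `q'` is the closure of `q`: `q' u = lim q(uᵢ)` for every `q`-Cauchy net `(uᵢ)` in `D(q)` that
`τ`-converges to `u`, and `q' u = ∞` if there is no such net. This determines `q'`. -/
def IsClosureOf (τ : TopologicalSpace V) (q' q : QForm V) : Prop :=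
  (∀ (u : V) (F : Filter V), q.IsApproximation τ u F → Tendsto q F (𝓝 (q' u))) ∧
    ∀ u : V, (¬ ∃ F : Filter V, q.IsApproximation τ u F) → q' u = ∞

end QForm

/-! ### Measure spaces, `L⁰` and `L²` -/

variable {X : Type*} [MeasurableSpace X]

/-- Semi-finite measures. -/
def IsSemiFinite (m : Measure X) : Prop :=
  ∀ A : Set X, MeasurableSet A → m A = ∞ →
    ∃ A' : Set X, A' ⊆ A ∧ MeasurableSet A' ∧ 0 < m A' ∧ m A' < ∞

/-- Localizable measures: semi-finite, and every collection of measurable sets has an essential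
supremum. -/
def IsLocalizable (m : Measure X) : Prop :=
  IsSemiFinite m ∧
    ∀ 𝒜 : Set (Set X), (∀ A ∈ 𝒜, MeasurableSet A) →
      ∃ S : Set X, MeasurableSet S ∧ (∀ A ∈ 𝒜, m (A \ S) = 0) ∧
        ∀ G : Set X, MeasurableSet G → (∀ A ∈ 𝒜, m (A \ G) = 0) → m (S \ G) = 0

/-- The pseudometric `d_U(f, g) = ∫_U |f - g| ∧ 1 dm` on `L⁰(m)`, for `U` of finite measure. -/
def localDist (m : Measure X) (U : Set X) (f g : X →ₘ[m] ℝ) : ℝ :=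
  ∫ x in U, min |f x - g x| 1 ∂m

/-- The topology `τ(m)` of local convergence in measure on `L⁰(m)`: the smallest topology
containing all balls of the pseudometrics `d_U`, `U` measurable of finite measure. -/
@[reducible]
def localMeasureTopology (m : Measure X) : TopologicalSpace (X →ₘ[m] ℝ) :=
  TopologicalSpace.generateFrom
    {B | ∃ (U : Set X) (g : X →ₘ[m] ℝ) (r : ℝ), MeasurableSet U ∧ m U < ∞ ∧ 0 < r ∧
      B = {f | localDist m U f g < r}}

/-- `C : ℝ → ℝ` is an `ε`-cutoff: a monotone normal contraction with values in `[-ε, 1 + ε]` and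
`C x = x` for `x ∈ [0, 1]`. -/
structure IsCutoff (ε : ℝ) (C : ℝ → ℝ) : Prop where
  map_zero : C 0 = 0
  lipschitz : LipschitzWith 1 C
  monotone : Monotone C
  mem_Icc : ∀ x : ℝ, C x ∈ Set.Icc (-ε) (1 + ε)
  eq_self : ∀ x ∈ Set.Icc (0 : ℝ) 1, C x = x

/-- Markovian quadratic forms on `L²(m)`; `compLp` is the composition `C ∘ u` in `L²(m)`. -/
def IsMarkovian {m : Measure X} (E : QForm (Lp ℝ 2 m)) : Prop :=
  ∀ ε : ℝ, 0 < ε → ∃ (C : ℝ → ℝ) (hC : IsCutoff ε C),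
    ∀ u : Lp ℝ 2 m, E (hC.lipschitz.compLp hC.map_zero u) ≤ E u

/-- Dirichlet forms on `L²(m)`: quadratic forms that are closed with respect to the norm topology
and Markovian. The domain need not be dense. -/
def IsDirichletForm {m : Measure X} (E : QForm (Lp ℝ 2 m)) : Prop :=
  E.IsClosedForm inferInstance ∧ IsMarkovian E

open Classical in
/-- A quadratic form on `L²(m)` viewed as a quadratic form on `L⁰(m)`, with the value `∞` outside
`L²(m)`. -/
def onL0 {m : Measure X} (E : QForm (Lp ℝ 2 m)) : QForm (X →ₘ[m] ℝ) where
  toFun := fun f => if h : f ∈ Lp ℝ 2 m then E ⟨f, h⟩ else ∞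
  parallelogram' := by
    intro u v
    by_cases hu : u ∈ Lp ℝ 2 m
    · by_cases hv : v ∈ Lp ℝ 2 m
      · have h := E.parallelogram' ⟨u, hu⟩ ⟨v, hv⟩
        simp only [hu, hv, sub_mem hu hv, add_mem hu hv, dite_true]
        exact h
      · have h1 : u + v ∉ Lp ℝ 2 m := fun h => hv (by simpa using sub_mem h hu)
        simp [hv, h1]
    · have h2 : ¬ (u - v ∈ Lp ℝ 2 m ∧ u + v ∈ Lp ℝ 2 m) := by
        rintro ⟨ha, hb⟩
        apply hu
        have hc := Lp.const_smul_mem_Lp (1 / 2 : ℝ) ⟨_, add_mem ha hb⟩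
        have hd : (1 / 2 : ℝ) • (u - v + (u + v)) = u := by
          rw [show u - v + (u + v) = (2 : ℝ) • u by rw [two_smul]; abel, smul_smul]
          norm_num
        rw [← hd]
        exact hc
      rw [not_and_or] at h2
      rcases h2 with h | h <;> simp [hu, h]
  homogeneous' := by
    intro c u
    by_cases hu : u ∈ Lp ℝ 2 m
    · have hc : c • u ∈ Lp ℝ 2 m := Lp.const_smul_mem_Lp c ⟨u, hu⟩
      simp only [hu, hc, dite_true]
      exact E.homogeneous' c ⟨u, hu⟩
    · by_cases h0 : c = 0
      · subst h0
        have hz : (0 : X →ₘ[m] ℝ) ∈ Lp ℝ 2 m := zero_mem _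
        have h1 : E ⟨0, hz⟩ = 0 := E.map_zero
        simp [h1]
      · have hc : c • u ∉ Lp ℝ 2 m := by
          intro h
          apply hu
          have hd := Lp.const_smul_mem_Lp c⁻¹ ⟨_, h⟩
          have he : c⁻¹ • c • u = u := inv_smul_smul₀ h0 u
          rw [← he]
          exact hd
        have hpos : ENNReal.ofReal (|c| ^ 2) ≠ 0 := by
          have : 0 < |c| ^ 2 := by positivity
          exact (ENNReal.ofReal_pos.2 this).ne'
        simp only [hu, hc, dite_false]
        rw [ENNReal.mul_top hpos]

/-- `Ee` is the extended Dirichlet form of `E`: the closure of `E` on `L⁰(m)` with respect to the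
topology of local convergence in measure. -/
def IsExtendedForm {m : Measure X} (E : QForm (Lp ℝ 2 m)) (Ee : QForm (X →ₘ[m] ℝ)) : Prop :=
  QForm.IsClosureOf (localMeasureTopology m) Ee (onL0 E)

end FormTheory

end

open FormTheory

/-! A form on a Hausdorff, complete topological vector space has a closure as soon as `q → 0` along
every `q`-Cauchy net that converges to `0`. The limit of `q` along an approximation then depends
only on the vector approximated; these limits form a quadratic form (`QForm.exists_isClosureOf`),
closed by completeness (`QForm.IsClosureOf.isClosedForm`) and minimal by Hausdorffness
(`QForm.IsClosureOf.isExtension_of_isClosedForm`). For `τ(m)`, semi-finiteness gives Hausdorffness,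
and localizability gives completeness because local limits can be glued.

The criterion for Dirichlet forms (`IsDirichletForm.tendsto_zero`) rests on a weak lower
semicontinuity, `energy_le_of_tendsto`: if `wᵢ → w₀` locally in measure inside the domain and `E(wᵢ)
≤ c`, then `E(w₀) ≤ 4c`. Duality proves it. By the Markov property the 1-resolvents of indicators of
finite-measure sets take values in `[0,1]`, and by symmetry they are integrable. Hence there is a
form-dense set of `g` with `E(·, g) = ⟨·, φ⟩`, `φ` in both `L¹` and `L²`. Truncations of `wᵢ` have
energy at most `4c`, and being bounded they can be tested against `φ` under local convergence in
measure. This bounds `|E(w₀, g)|`, and density permits `g = w₀`. For an `E`-Cauchy net `(u)` tending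
to `0` and a late member `w₀`, the vectors `w₀ - u` tend to `w₀` with small energy, so `E(w₀)` is
small. The factor 4 is harmless. -/

namespace FormTheory

/-! ### The Jordan-von Neumann theorem for real-valued quadratic forms -/

section Polar

variable {W : Type*} [AddCommGroup W] [Module ℝ W]

/-- Nonnegative real-valued maps that satisfy the parallelogram identity and are homogeneous of
degree two. -/
structure IsParallelogramForm (Q : W → ℝ) : Prop where
  nonneg : ∀ u, 0 ≤ Q u
  parallelogram : ∀ u v, 2 * Q u + 2 * Q v = Q (u - v) + Q (u + v)
  smul : ∀ (c : ℝ) u, Q (c • u) = c ^ 2 * Q u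

namespace IsParallelogramForm

variable {Q : W → ℝ}

theorem map_zero (hQ : IsParallelogramForm Q) : Q 0 = 0 := by
  simpa using hQ.smul 0 0

theorem map_neg (hQ : IsParallelogramForm Q) (u : W) : Q (-u) = Q u := by
  simpa using hQ.smul (-1) u

theorem map_sub_comm (hQ : IsParallelogramForm Q) (u v : W) : Q (u - v) = Q (v - u) := by
  rw [← hQ.map_neg, neg_sub]

/-- Four parallelogram identities are combined with alternating signs; evenness of `Q` cancels the
mixed terms. -/
theorem polar_add (hQ : IsParallelogramForm Q) (u u' v : W) :
    Q (u + u' + v) - Q (u + u' - v) = (Q (u + v) - Q (u - v)) + (Q (u' + v) - Q (u' - v)) := by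
  have h1 := hQ.parallelogram (u + v) u'
  have h2 := hQ.parallelogram (u' + v) u
  have h3 := hQ.parallelogram (u - v) u'
  have h4 := hQ.parallelogram (u' - v) u
  have e1 := hQ.map_sub_comm (u + v) u'
  have e2 := hQ.map_sub_comm (u' + v) u
  rw [show u + v + u' = u + u' + v by abel] at h1
  rw [show u' + v + u = u + u' + v by abel] at h2
  rw [show u - v + u' = u + u' - v by abel] at h3
  rw [show u' - v + u = u + u' - v by abel] at h4
  rw [show u' - (u + v) = u' - v - u by abel] at e1
  rw [show u - (u' + v) = u - v - u' by abel] at e2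
  linarith

theorem abs_polar_le (hQ : IsParallelogramForm Q) (u v : W) :
    |Q (u + v) - Q (u - v)| ≤ 2 * Q u + 2 * Q v := by
  have h := hQ.parallelogram u v
  rw [abs_le]
  constructor <;> linarith [hQ.nonneg (u - v), hQ.nonneg (u + v)]

/-- In the scalar the polar form is additive and bounded near `0`. An additive real function bounded
near `0` is continuous, hence linear. -/
theorem polar_smul (hQ : IsParallelogramForm Q) (c : ℝ) (u v : W) :
    Q (c • u + v) - Q (c • u - v) = c * (Q (u + v) - Q (u - v)) := by
  let f : ℝ →+ ℝ :=
    { toFun := fun t => Q (t • u + v) - Q (t • u - v)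
      map_zero' := by simp [hQ.map_neg]
      map_add' := fun s t => by
        rw [add_smul]
        exact hQ.polar_add _ _ _ }
  have hf : Continuous f := by
    refine f.continuous_of_isBounded_nhds_zero (Metric.ball_mem_nhds 0 one_pos) ?_
    refine (Metric.isBounded_iff_subset_closedBall 0).2 ⟨2 * Q u + 2 * Q v, ?_⟩
    rintro _ ⟨t, ht, rfl⟩
    rw [mem_closedBall_zero_iff, Real.norm_eq_abs]
    refine (hQ.abs_polar_le (t • u) v).trans ?_
    rw [hQ.smul]
    have ht1 : t ^ 2 ≤ 1 := by
      rw [sq_le_one_iff_abs_le_one]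
      simpa using (mem_ball_zero_iff.1 ht).le
    nlinarith [mul_le_mul_of_nonneg_right ht1 (hQ.nonneg u)]
  have h := map_real_smul f hf c 1
  simpa [f] using h

/-- The symmetric bilinear form of a parallelogram form. -/
noncomputable def bilin (hQ : IsParallelogramForm Q) : W →ₗ[ℝ] W →ₗ[ℝ] ℝ :=
  have hc : ∀ u v : W, (Q (u + v) - Q (u - v)) / 4 = (Q (v + u) - Q (v - u)) / 4 := fun u v => by
    rw [add_comm, hQ.map_sub_comm]
  LinearMap.mk₂ ℝ (fun u v => (Q (u + v) - Q (u - v)) / 4)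
    (fun u u' v => by rw [hQ.polar_add]; ring)
    (fun c u v => by rw [hQ.polar_smul, smul_eq_mul]; ring)
    (fun u v v' => by rw [hc, hc u v, hc u v', hQ.polar_add]; ring)
    (fun c u v => by rw [hc, hc u v, hQ.polar_smul, smul_eq_mul]; ring)

theorem bilin_self (hQ : IsParallelogramForm Q) (u : W) : hQ.bilin u u = Q u := by
  change (Q (u + u) - Q (u - u)) / 4 = Q u
  rw [sub_self, hQ.map_zero, ← two_smul ℝ u, hQ.smul]
  ring

theorem bilin_comm (hQ : IsParallelogramForm Q) (u v : W) : hQ.bilin u v = hQ.bilin v u := by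
  change (Q (u + v) - Q (u - v)) / 4 = (Q (v + u) - Q (v - u)) / 4
  rw [add_comm, hQ.map_sub_comm]

/-- A parallelogram form as a semi-definite inner product. -/
@[reducible]
noncomputable def preCore (hQ : IsParallelogramForm Q) : PreInnerProductSpace.Core ℝ W where
  inner u v := hQ.bilin u v
  conj_inner_symm u v := hQ.bilin_comm v u
  re_inner_nonneg u := by
    change 0 ≤ hQ.bilin u u
    rw [hQ.bilin_self]
    exact hQ.nonneg u
  add_left u v w := by simp
  smul_left u v c := by simp

theorem sqrt_add_le (hQ : IsParallelogramForm Q) (u v : W) : √(Q (u + v)) ≤ √(Q u) + √(Q v) := by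
  let := hQ.preCore
  let : SeminormedAddCommGroup W := InnerProductSpace.Core.toSeminormedAddCommGroup (𝕜 := ℝ)
  have h : ∀ w : W, ‖w‖ = √(Q w) := fun w => by
    rw [← hQ.bilin_self]
    rfl
  simpa only [h] using norm_add_le u v

theorem abs_bilin_le (hQ : IsParallelogramForm Q) (u v : W) :
    |hQ.bilin u v| ≤ √(Q u) * √(Q v) := by
  let := hQ.preCore
  have h := InnerProductSpace.Core.norm_inner_le_norm (𝕜 := ℝ) u v
  have h' : ∀ w : W, √(hQ.bilin w w) = √(Q w) := fun w => by rw [hQ.bilin_self]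
  rw [← h', ← h']
  exact h

end IsParallelogramForm

end Polar

/-! ### Topologies generated by balls -/

section Balls

variable {α ι : Type*}

/-- The generating balls have arbitrary centres; by the triangle inequality each one containing `a`
includes a smaller ball about `a`. The form seminorm and `τ(m)` are both handled through this. -/
theorem le_nhds_generateFrom_balls {𝒰 : Set (Set α)} {d : ι → α → α → ℝ}
    (h𝒰 : ∀ B, B ∈ 𝒰 ↔ ∃ (i : ι) (g : α) (r : ℝ), 0 < r ∧ B = {f | d i f g < r})
    (h0 : ∀ i f g, 0 ≤ d i f g) (hself : ∀ i f, d i f f = 0)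
    (htri : ∀ i f g h, d i f h ≤ d i f g + d i g h) (a : α) (F : Filter α) :
    F ≤ @nhds α (TopologicalSpace.generateFrom 𝒰) a ↔
      ∀ i, Tendsto (fun f => d i f a) F (𝓝 0) := by
  rw [TopologicalSpace.nhds_generateFrom]
  simp only [le_iInf_iff, le_principal_iff]
  constructor
  · intro h i
    rw [Metric.tendsto_nhds]
    intro ε hε
    have := h {f | d i f a < ε} ⟨by simpa [hself] using hε, (h𝒰 _).2 ⟨i, a, ε, hε, rfl⟩⟩
    filter_upwards [this] with f hf
    rwa [Real.dist_0_eq_abs, abs_of_nonneg (h0 _ _ _)]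
  · rintro h s ⟨has, hs⟩
    obtain ⟨i, g, r, -, rfl⟩ := (h𝒰 s).1 hs
    have has' : d i a g < r := has
    filter_upwards [(h i).eventually (gt_mem_nhds (sub_pos.2 has'))] with f hf
    exact lt_of_le_of_lt (htri i f a g) (by linarith)

end Balls

/-! ### Form seminorms and convergence in the form topology -/

namespace QForm

variable {V : Type*} [AddCommGroup V] [Module ℝ V]

theorem isParallelogramForm (q : QForm V) :
    IsParallelogramForm fun u : q.domain => (q (u : V)).toReal where
  nonneg u := ENNReal.toReal_nonneg
  parallelogram u v := by
    have fin : ∀ w : q.domain, q (w : V) ≠ ∞ := fun w => ne_of_lt w.2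
    have h := congrArg ENNReal.toReal (q.parallelogram' u v)
    have h' := ENNReal.toReal_add (fin (u - v)) (fin (u + v))
    rw [ENNReal.toReal_add (ENNReal.mul_ne_top (by simp) (fin u))
      (ENNReal.mul_ne_top (by simp) (fin v)), ENNReal.toReal_mul, ENNReal.toReal_mul] at h
    exact h.trans h'
  smul c u := by
    change (q (c • (u : V))).toReal = _
    rw [q.homogeneous', ENNReal.toReal_mul, ENNReal.toReal_ofReal (by positivity), sq_abs]

theorem map_smul (q : QForm V) (c : ℝ) (u : V) : q (c • u) = ENNReal.ofReal (c ^ 2) * q u := by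
  rw [q.homogeneous', sq_abs]

theorem map_neg (q : QForm V) (u : V) : q (-u) = q u := by
  simpa using q.map_smul (-1) u

theorem map_sub_comm (q : QForm V) (u v : V) : q (u - v) = q (v - u) := by
  rw [← q.map_neg, neg_sub]

theorem map_sub_le (q : QForm V) (u v : V) : q (u - v) ≤ 2 * q u + 2 * q v := by
  rw [q.parallelogram']
  exact le_self_add

/-- The triangle inequality of the form seminorm. -/
theorem sqrt_add_le (q : QForm V) (u v : V) :
    q (u + v) ^ (1 / 2 : ℝ) ≤ q u ^ (1 / 2 : ℝ) + q v ^ (1 / 2 : ℝ) := by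
  by_cases hu : q u = ∞
  · simp [hu]
  by_cases hv : q v = ∞
  · simp [hv]
  have hu' : q u < ∞ := lt_top_iff_ne_top.2 hu
  have hv' : q v < ∞ := lt_top_iff_ne_top.2 hv
  have key : ∀ w : V, q w < ∞ → q w ^ (1 / 2 : ℝ) = ENNReal.ofReal (√(q w).toReal) := by
    intro w hw
    rw [Real.sqrt_eq_rpow, ENNReal.toReal_rpow, ENNReal.ofReal_toReal]
    exact ENNReal.rpow_ne_top_of_nonneg (by norm_num) hw.ne
  rw [key _ hu', key _ hv', key _ (q.map_add_lt_top hu' hv'),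
    ← ENNReal.ofReal_add (Real.sqrt_nonneg _) (Real.sqrt_nonneg _)]
  exact ENNReal.ofReal_le_ofReal (q.isParallelogramForm.sqrt_add_le ⟨u, hu'⟩ ⟨v, hv'⟩)

/-- Forms are continuous with respect to their own seminorm. -/
theorem tendsto_of_tendsto_sub (q : QForm V) {α : Type*} {l : Filter α} {f g : α → V} {L : ℝ≥0∞}
    (hg : Tendsto (fun x => q (g x)) l (𝓝 L)) (hfg : Tendsto (fun x => q (f x - g x)) l (𝓝 0)) :
    Tendsto (fun x => q (f x)) l (𝓝 L) := by
  -- The triangle inequality holds for `q^{1/2}`: squeeze there between `q(g)^{1/2} ∓ q(f-g)^{1/2}`,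
  -- then square. The value `L = ∞` is allowed.
  have hs : ∀ w : V, (q w ^ (1 / 2 : ℝ)) ^ (2 : ℝ) = q w := fun w => by
    rw [← ENNReal.rpow_mul]; norm_num
  have hc : ∀ {h : α → V} {K : ℝ≥0∞}, Tendsto (fun x => q (h x)) l (𝓝 K) →
      Tendsto (fun x => q (h x) ^ (1 / 2 : ℝ)) l (𝓝 (K ^ (1 / 2 : ℝ))) := fun h =>
    (ENNReal.continuous_rpow_const.tendsto _).comp h
  have h1 := hc hg
  have h2 := hc (h := fun x => f x - g x) hfg
  rw [ENNReal.zero_rpow_of_pos (by norm_num)] at h2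
  have h3 : Tendsto (fun x => q (f x) ^ (1 / 2 : ℝ)) l (𝓝 (L ^ (1 / 2 : ℝ))) := by
    refine tendsto_of_tendsto_of_tendsto_of_le_of_le
      (g := fun x => q (g x) ^ (1 / 2 : ℝ) - q (f x - g x) ^ (1 / 2 : ℝ))
      (h := fun x => q (g x) ^ (1 / 2 : ℝ) + q (f x - g x) ^ (1 / 2 : ℝ)) ?_ ?_ ?_ ?_
    · simpa using ENNReal.Tendsto.sub h1 h2 (Or.inr ENNReal.zero_ne_top)
    · simpa using h1.add h2
    · intro x
      refine tsub_le_iff_right.2 ?_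
      have := q.sqrt_add_le (f x) (g x - f x)
      rwa [add_sub_cancel, q.map_sub_comm (g x)] at this
    · intro x
      have := q.sqrt_add_le (g x) (f x - g x)
      rwa [add_sub_cancel] at this
  have h4 := (ENNReal.continuous_rpow_const (y := (2 : ℝ))).tendsto _ |>.comp h3
  have hL : (L ^ (1 / 2 : ℝ)) ^ (2 : ℝ) = L := by
    rw [← ENNReal.rpow_mul]; norm_num
  rw [hL] at h4
  exact h4.congr fun x => hs _

theorem tendsto_map_add_zero (q : QForm V) {α : Type*} {l : Filter α} {f g : α → V}
    (hf : Tendsto (fun x => q (f x)) l (𝓝 0)) (hg : Tendsto (fun x => q (g x)) l (𝓝 0)) :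
    Tendsto (fun x => q (f x + g x)) l (𝓝 0) :=
  q.tendsto_of_tendsto_sub hg (by simpa using hf)

theorem tendsto_map_sub_zero (q : QForm V) {α : Type*} {l : Filter α} {f g : α → V}
    (hf : Tendsto (fun x => q (f x)) l (𝓝 0)) (hg : Tendsto (fun x => q (g x)) l (𝓝 0)) :
    Tendsto (fun x => q (f x - g x)) l (𝓝 0) := by
  simpa only [sub_eq_add_neg] using q.tendsto_map_add_zero hf (g := fun x => -g x)
    (by simpa only [q.map_neg] using hg)

theorem le_nhds_formTopology (τ : TopologicalSpace V) (q : QForm V) (x : q.domain)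
    (F : Filter q.domain) :
    F ≤ @nhds _ (q.formTopology τ) x ↔
      Tendsto (fun v : q.domain => (v : V)) F (@nhds V τ x) ∧
        Tendsto (fun v : q.domain => q ((v : V) - x)) F (𝓝 0) := by
  rw [nhds_inf, le_inf_iff, nhds_induced, ← tendsto_iff_comap]
  refine and_congr Iff.rfl ?_
  have hQ := q.isParallelogramForm
  rw [le_nhds_generateFrom_balls (ι := Unit) (d := fun _ f g => q.formSeminorm (f - g))
    (fun B => by simp) (fun _ _ _ => Real.sqrt_nonneg _)
    (fun _ f => by simp [formSeminorm, q.map_zero])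
    (fun _ f g h => by
      have := hQ.sqrt_add_le (f - g) (g - h)
      rwa [sub_add_sub_cancel] at this)]
  have key : ∀ v : q.domain, q ((v : V) - x) = ENNReal.ofReal (q.formSeminorm (v - x) ^ 2) := by
    intro v
    have hfin : q ((v : V) - x) ≠ ∞ := ne_of_lt (v - x).2
    rw [formSeminorm, Real.sq_sqrt ENNReal.toReal_nonneg]
    exact (ENNReal.ofReal_toReal hfin).symm
  simp only [forall_const, key]
  constructor
  · intro h
    simpa using ENNReal.tendsto_ofReal (h.pow 2)
  · intro h
    have h1 := (Real.continuous_sqrt.tendsto _).comp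
      ((ENNReal.tendsto_toReal ENNReal.zero_ne_top).comp h)
    simp only [ENNReal.toReal_zero, Real.sqrt_zero] at h1
    refine h1.congr fun v => ?_
    simp only [Function.comp_apply]
    rw [ENNReal.toReal_ofReal (by positivity),
      Real.sqrt_sq (show 0 ≤ q.formSeminorm (v - x) from Real.sqrt_nonneg _)]

end QForm

/-! ### Approximations and the closure of a form -/

namespace QForm

variable {V : Type*} [AddCommGroup V] [Module ℝ V]

theorem tendsto_map_smul_zero {q : QForm V} {α : Type*} {l : Filter α} {f : α → V} (c : ℝ)
    (hf : Tendsto (fun x => q (f x)) l (𝓝 0)) : Tendsto (fun x => q (c • f x)) l (𝓝 0) := by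
  simp only [q.map_smul]
  simpa using ENNReal.Tendsto.const_mul hf (Or.inr ENNReal.ofReal_ne_top)

section Approximation

variable [τ : TopologicalSpace V] {q : QForm V}

theorem isApproximation_map_iff {α : Type*} {l : Filter α} [l.NeBot] {f : α → V} {u : V} :
    q.IsApproximation τ u (map f l) ↔ (∀ᶠ x in l, q (f x) < ∞) ∧
      Tendsto (fun p : α × α => q (f p.1 - f p.2)) (l ×ˢ l) (𝓝 0) ∧ Tendsto f l (𝓝 u) := by
  constructor
  · intro h
    refine ⟨h.domain_mem, ?_, h.tendsto⟩
    have := h.cauchy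
    rwa [prod_map_map_eq, tendsto_map'_iff] at this
  · rintro ⟨h1, h2, h3⟩
    refine ⟨inferInstance, h1, ?_, h3⟩
    rwa [prod_map_map_eq, tendsto_map'_iff]

theorem isApproximation_pure {u : V} (hu : q u < ∞) : q.IsApproximation τ u (pure u) where
  neBot := inferInstance
  domain_mem := mem_pure.2 hu
  cauchy := by
    rw [prod_pure_pure, tendsto_pure_left]
    intro s hs
    simpa [q.map_zero] using mem_of_mem_nhds hs
  tendsto := pure_le_nhds u

/-- Along an approximation a form converges, and its limit is finite. -/
theorem IsApproximation.exists_tendsto {u : V} {F : Filter V} (hF : q.IsApproximation τ u F) :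
    ∃ L, L < ∞ ∧ Tendsto q F (𝓝 L) := by
  have := hF.neBot
  -- Compactness of `[0, ∞]` gives a limit along a finer ultrafilter; the Cauchy property carries it
  -- over to all of `F`.
  obtain ⟨L, -, hL⟩ := isCompact_univ.ultrafilter_le_nhds ((Ultrafilter.of F).map q) (by simp)
  have h𝒰 : (Ultrafilter.of F : Filter V) ≤ F := Ultrafilter.of_le F
  have hF' : Tendsto q F (𝓝 L) := by
    have h1 := q.tendsto_of_tendsto_sub (l := F ×ˢ (Ultrafilter.of F : Filter V)) (f := Prod.fst)
      (g := Prod.snd) (L := L) (Tendsto.comp (show Tendsto q _ _ from hL) tendsto_snd)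
      (hF.cauchy.mono_left (prod_mono le_rfl h𝒰))
    have h2 := (tendsto_map'_iff (f := q) (g := Prod.fst)).2 h1
    rwa [map_fst_prod] at h2
  refine ⟨L, ?_, hF'⟩
  -- Finiteness: fix one `f` in the domain with `q(f - g) < 1` for all late `g`, so `q(g)` is
  -- bounded by `2q(f) + 2`.
  have h1 := (hF.cauchy.eventually (gt_mem_nhds one_pos)).curry.and hF.domain_mem
  obtain ⟨f, hf, hfd⟩ := h1.exists
  refine lt_of_le_of_lt (le_of_tendsto hF' (b := 2 * q f + 2 * 1) ?_) ?_
  · filter_upwards [hf] with g hg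
    have := q.map_sub_le f (f - g)
    rw [sub_sub_cancel] at this
    exact this.trans (by gcongr)
  · exact ENNReal.add_lt_top.2 ⟨ENNReal.mul_lt_top (by simp) hfd, by simp⟩

theorem IsClosureOf.unique {q₁ q₂ : QForm V} (h₁ : IsClosureOf τ q₁ q) (h₂ : IsClosureOf τ q₂ q) :
    q₁ = q₂ := by
  have h : q₁.toFun = q₂.toFun := by
    funext u
    by_cases h : ∃ F, q.IsApproximation τ u F
    · obtain ⟨F, hF⟩ := h
      have := hF.neBot
      exact tendsto_nhds_unique (h₁.1 u F hF) (h₂.1 u F hF)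
    · rw [h₁.2 u h, h₂.2 u h]
  cases q₁
  cases q₂
  congr

variable {E : QForm V}

theorem IsClosureOf.exists_approximation (hE : IsClosureOf τ E q) {u : V} (hu : E u < ∞) :
    ∃ F, q.IsApproximation τ u F := by
  by_contra h
  exact hu.ne (hE.2 u h)

theorem IsClosureOf.lt_top (hE : IsClosureOf τ E q) {u : V} {F : Filter V}
    (hF : q.IsApproximation τ u F) : E u < ∞ := by
  have := hF.neBot
  obtain ⟨L, hL, hFL⟩ := hF.exists_tendsto
  rwa [tendsto_nhds_unique (hE.1 u F hF) hFL]

theorem IsClosureOf.eq_of_lt_top (hE : IsClosureOf τ E q) {u : V} (hu : q u < ∞) : E u = q u := by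
  have h := hE.1 u _ (isApproximation_pure hu)
  exact (tendsto_nhds_unique h (tendsto_pure_nhds q.toFun u))

theorem IsClosureOf.isExtension (hE : IsClosureOf τ E q) : q.IsExtension E := by
  refine ⟨fun u hu => ?_, fun u hu => hE.eq_of_lt_top hu⟩
  change E u < ∞
  rwa [hE.eq_of_lt_top hu]

variable [IsTopologicalAddGroup V]

/-- The closure is the smallest closed extension. -/
theorem IsClosureOf.isExtension_of_isClosedForm [T2Space V] (hE : IsClosureOf τ E q) {q' : QForm V}
    (hc : q'.IsClosedForm τ) (hq' : q.IsExtension q') : E.IsExtension q' := by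
  have key : ∀ u, E u < ∞ → q' u < ∞ ∧ q' u = E u := by
    intro u hu
    obtain ⟨F, hF⟩ := hE.exists_approximation hu
    have := hF.neBot
    have hmem : (q'.domain : Set V) ∈ F := mem_of_superset hF.domain_mem hq'.1
    let ι : q'.domain → V := fun v => v
    have : (comap ι F).NeBot := by
      refine comap_neBot_iff.2 fun t ht => ?_
      obtain ⟨g, hg1, hg2⟩ := F.nonempty_of_mem (inter_mem ht hmem)
      exact ⟨⟨g, hg2⟩, hg1⟩
    have hι : Tendsto ι (comap ι F) F := tendsto_comap
    have hmap : map ι (comap ι F) = F := map_comap_of_mem (by simpa [ι] using hmem)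
    -- Since `q' = q` on `D(q)`, the approximation is Cauchy in the form topology of `q'`. Its limit
    -- there is `u` because `τ` is Hausdorff, and the two limits of the form along `F` agree.
    obtain ⟨x, hx⟩ := hc (comap ι F) inferInstance (by
      refine (le_nhds_formTopology τ q' 0 _).2 ⟨?_, ?_⟩
      · rw [tendsto_map'_iff]
        have h := hι.mono_right hF.tendsto
        simpa [ι, Function.comp_def] using
          (h.comp (tendsto_fst (g := comap ι F))).sub (h.comp (tendsto_snd (f := comap ι F)))
      · rw [tendsto_map'_iff]
        refine (hF.cauchy.comp (hι.prodMap hι)).congr' ?_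
        filter_upwards [(hι.prodMap hι).eventually (prod_mem_prod hF.domain_mem hF.domain_mem)]
          with p hp
        simpa [ι] using (hq'.2 _ (q.domain.sub_mem hp.1 hp.2)).symm)
    obtain ⟨hx1, hx2⟩ := (le_nhds_formTopology τ q' x _).1 hx
    have hxu : (x : V) = u := tendsto_nhds_unique hx1 (hι.mono_right hF.tendsto)
    have h1 := q'.tendsto_of_tendsto_sub (tendsto_const_nhds (x := q' (x : V))) hx2
    have h2 : Tendsto q' F (𝓝 (q' (x : V))) := by
      rw [← hmap]
      exact tendsto_map'_iff.2 h1
    have h3 : Tendsto q' F (𝓝 (E u)) := by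
      refine (hE.1 u F hF).congr' ?_
      filter_upwards [hF.domain_mem] with v hv
      exact (hq'.2 v hv).symm
    rw [← hxu]
    exact ⟨x.2, by rw [tendsto_nhds_unique h2 h3, hxu]⟩
  exact ⟨fun u hu => (key u hu).1, fun u hu => (key u hu).2⟩

variable [ContinuousConstSMul ℝ V]

theorem IsApproximation.linear {u v : V} {F G : Filter V} (hF : q.IsApproximation τ u F)
    (hG : q.IsApproximation τ v G) (a b : ℝ) :
    q.IsApproximation τ (a • u + b • v) (map (fun p : V × V => a • p.1 + b • p.2) (F ×ˢ G)) := by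
  have := hF.neBot
  have := hG.neBot
  have hf := tendsto_fst (f := F) (g := G)
  have hg := tendsto_snd (f := F) (g := G)
  refine isApproximation_map_iff.2 ⟨?_, ?_, ?_⟩
  · filter_upwards [hf.eventually hF.domain_mem, hg.eventually hG.domain_mem] with p hp1 hp2
    exact (q.domain.add_mem (q.domain.smul_mem a hp1) (q.domain.smul_mem b hp2) : _ ∈ q.domain)
  · have h1 := hF.cauchy.comp (hf.prodMap hf)
    have h2 := hG.cauchy.comp (hg.prodMap hg)
    refine (q.tendsto_map_add_zero (tendsto_map_smul_zero a h1)
      (tendsto_map_smul_zero b h2)).congr fun p => ?_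
    congr 1
    simp only [Prod.map_fst, Prod.map_snd, smul_sub]
    abel
  · exact ((hf.mono_right hF.tendsto).const_smul a).add ((hg.mono_right hG.tendsto).const_smul b)

theorem IsApproximation.sub {u v : V} {F G : Filter V} (hF : q.IsApproximation τ u F)
    (hG : q.IsApproximation τ v G) :
    q.IsApproximation τ (u - v) (map (fun p : V × V => p.1 - p.2) (F ×ˢ G)) := by
  simpa [sub_eq_add_neg] using hF.linear hG 1 (-1)

theorem IsApproximation.add {u v : V} {F G : Filter V} (hF : q.IsApproximation τ u F)
    (hG : q.IsApproximation τ v G) :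
    q.IsApproximation τ (u + v) (map (fun p : V × V => p.1 + p.2) (F ×ˢ G)) := by
  simpa using hF.linear hG 1 1

theorem IsApproximation.smul {u : V} {F : Filter V} (hF : q.IsApproximation τ u F) (c : ℝ) :
    q.IsApproximation τ (c • u) (map (fun p : V => c • p) F) := by
  have := hF.neBot
  have h := hF.linear hF c 0
  have h2 : (fun p : V × V => c • p.1 + (0 : ℝ) • p.2) = (fun p => c • p) ∘ Prod.fst := by
    ext p; simp
  rw [h2, ← map_map, map_fst_prod, zero_smul, add_zero] at h
  exact h

/-- If `q → 0` along every approximation of `0`, then all approximations of a vector yield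
the same limit. -/
theorem IsApproximation.tendsto_of_tendsto
    (hq : ∀ F : Filter V, q.IsApproximation τ 0 F → Tendsto q F (𝓝 0)) {u : V} {F G : Filter V}
    (hF : q.IsApproximation τ u F) (hG : q.IsApproximation τ u G) {L : ℝ≥0∞}
    (hL : Tendsto q F (𝓝 L)) : Tendsto q G (𝓝 L) := by
  have := hF.neBot
  have h1 := hG.sub hF
  rw [sub_self] at h1
  have h2 := q.tendsto_of_tendsto_sub (l := G ×ˢ F) (f := Prod.fst) (g := Prod.snd)
    (hL.comp tendsto_snd) (tendsto_map'_iff.1 (hq _ h1))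
  have h3 := (tendsto_map'_iff (f := q) (g := Prod.fst)).2 h2
  rwa [map_fst_prod] at h3

/-- The hypothesis makes the limit independent of the approximation. The identities of a quadratic
form then pass to the limit; the value `∞` is consistent because the vectors with an approximation
form a subspace. -/
theorem exists_isClosureOf
    (hq : ∀ F : Filter V, q.IsApproximation τ 0 F → Tendsto q F (𝓝 0)) :
    ∃ q' : QForm V, IsClosureOf τ q' q := by
  have key : ∀ u : V, ∃ L : ℝ≥0∞, (∀ F, q.IsApproximation τ u F → Tendsto q F (𝓝 L)) ∧
      ((¬ ∃ F, q.IsApproximation τ u F) → L = ∞) := by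
    intro u
    by_cases h : ∃ F, q.IsApproximation τ u F
    · obtain ⟨F, hF⟩ := h
      obtain ⟨L, -, hL⟩ := hF.exists_tendsto
      exact ⟨L, fun G hG => hF.tendsto_of_tendsto hq hG hL, fun h => (h ⟨F, hF⟩).elim⟩
    · exact ⟨∞, fun F hF => (h ⟨F, hF⟩).elim, fun _ => rfl⟩
  choose E hE1 hE2 using key
  refine ⟨⟨E, fun u v => ?_, fun c u => ?_⟩, hE1, hE2⟩
  · by_cases h : (∃ F, q.IsApproximation τ u F) ∧ ∃ G, q.IsApproximation τ v G
    · obtain ⟨⟨F, hF⟩, G, hG⟩ := h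
      have := hF.neBot
      have := hG.neBot
      have h1 := tendsto_map'_iff.1 (hE1 _ _ (hF.sub hG))
      have h2 := tendsto_map'_iff.1 (hE1 _ _ (hF.add hG))
      have h3 := (hE1 _ _ hF).comp (tendsto_fst (g := G))
      have h4 := (hE1 _ _ hG).comp (tendsto_snd (f := F))
      refine tendsto_nhds_unique (((ENNReal.Tendsto.const_mul h3 (a := 2) (by simp)).add
        (ENNReal.Tendsto.const_mul h4 (a := 2) (by simp))).congr fun p => ?_) (h1.add h2)
      exact q.parallelogram' p.1 p.2
    -- Both `u` and `v` are combinations of `u - v` and `u + v`, so both sides of the identity are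
    -- infinite together.
    · have h' : ¬ ((∃ F, q.IsApproximation τ (u - v) F) ∧ ∃ G, q.IsApproximation τ (u + v) G) := by
        rintro ⟨⟨F, hF⟩, G, hG⟩
        have h1 := hF.linear hG (1 / 2) (1 / 2)
        have h2 := hF.linear hG (-(1 / 2)) (1 / 2)
        rw [show (1 / 2 : ℝ) • (u - v) + (1 / 2 : ℝ) • (u + v) = u by module] at h1
        rw [show (-(1 / 2) : ℝ) • (u - v) + (1 / 2 : ℝ) • (u + v) = v by module] at h2
        exact h ⟨⟨_, h1⟩, ⟨_, h2⟩⟩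
      rw [not_and_or] at h h'
      have hl : 2 * E u + 2 * E v = ∞ := by
        rcases h with h | h <;> simp [hE2 _ h]
      have hr : E (u - v) + E (u + v) = ∞ := by
        rcases h' with h | h <;> simp [hE2 _ h]
      rw [hl, hr]
  · rw [sq_abs]
    by_cases h : ∃ F, q.IsApproximation τ u F
    · obtain ⟨F, hF⟩ := h
      have := hF.neBot
      have h1 := tendsto_map'_iff.1 (hE1 _ _ (hF.smul c))
      refine tendsto_nhds_unique h1 ((ENNReal.Tendsto.const_mul (hE1 _ _ hF)
        (Or.inr ENNReal.ofReal_ne_top)).congr fun p => ?_)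
      exact (q.map_smul c p).symm
    -- For `c = 0` the convention `0·∞ = 0` requires the value at `0` to vanish, which the constant
    -- approximation shows.
    · rcases eq_or_ne c 0 with rfl | hc
      · have h0 := hE1 0 _ (isApproximation_pure (q := q) (by simp [q.map_zero]))
        rw [tendsto_pure_left] at h0
        have h1 : E 0 = 0 := by
          by_contra hne
          exact h0 {0}ᶜ (isOpen_ne.mem_nhds hne) q.map_zero
        simp [h1]
      · have h' : ¬ ∃ F, q.IsApproximation τ (c • u) F := by
          rintro ⟨F, hF⟩
          have := hF.smul c⁻¹
          rw [inv_smul_smul₀ hc] at this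
          exact h ⟨_, this⟩
        rw [hE2 _ h, hE2 _ h', ENNReal.mul_top]
        exact (ENNReal.ofReal_pos.2 (by positivity)).ne'

/-- Approximations converge with respect to the form seminorm of the closure. -/
theorem IsClosureOf.tendsto_sub (hE : IsClosureOf τ E q) {u : V} {F : Filter V}
    (hF : q.IsApproximation τ u F) : Tendsto (fun g => E (u - g)) F (𝓝 0) := by
  have := hF.neBot
  rw [ENNReal.tendsto_nhds_zero]
  intro ε hε
  have h := (ENNReal.tendsto_nhds_zero.1 hF.cauchy ε hε)
  have h' : ∀ᶠ p : V × V in F ×ˢ F, q (p.2 - p.1) ≤ ε := by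
    filter_upwards [h] with p hp
    rwa [q.map_sub_comm]
  -- For fixed `g`, the vectors `h - g` with `h` along `F` approximate `u - g`, so `E(u - g)` is the
  -- limit of `q(h - g) ≤ ε`.
  filter_upwards [h'.curry, hF.domain_mem] with g hg hgd
  have h1 := hF.sub (isApproximation_pure (τ := τ) (q := q) (u := g) hgd)
  rw [prod_pure, map_map] at h1
  exact le_of_tendsto (tendsto_map'_iff.1 (hE.1 _ _ h1)) hg

/-- A Cauchy filter on `D(E)` has a `τ`-limit `f`, but its members need not lie in `D(q)`. Replacing
them by form-close and `τ`-close elements of `D(q)` gives an approximation of `f`. -/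
theorem IsClosureOf.isClosedForm (hτ : IsCompleteVectorTopology τ) (hE : IsClosureOf τ E q) :
    E.IsClosedForm τ := by
  intro F hF hC
  obtain ⟨hC1, hC2⟩ := (le_nhds_formTopology τ E 0 _).1 hC
  rw [tendsto_map'_iff] at hC1 hC2
  set F' : Filter V := map (fun u : E.domain => (u : V)) F with hF'
  have hcauchy : Tendsto (fun p : V × V => E (p.1 - p.2)) (F' ×ˢ F') (𝓝 0) := by
    rw [hF', prod_map_map_eq, tendsto_map'_iff]
    simpa [Function.comp_def] using hC2
  obtain ⟨f, hf⟩ := hτ F' inferInstance (by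
    rw [hF', prod_map_map_eq, tendsto_map'_iff]
    exact hC1)
  -- `l` is the filter of pairs `(v, g)` with `v` late in `F'`, `g ∈ D(q)`, and `v - g` small both
  -- for `τ` and for `E`.
  let φ : V × q.domain → V × (V × ℝ≥0∞) := fun p => (p.1, (p.1 - p.2, E (p.1 - p.2)))
  let l : Filter (V × q.domain) := comap φ (F' ×ˢ (𝓝 0 ×ˢ 𝓝 0))
  have hl : Tendsto φ l (F' ×ˢ (𝓝 0 ×ˢ 𝓝 0)) := tendsto_comap
  have hl' := tendsto_snd.comp hl
  have hl1 : Tendsto Prod.fst l F' := by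
    have h := tendsto_fst.comp hl
    exact h
  have hl2 : Tendsto (fun p : V × q.domain => p.1 - (p.2 : V)) l (𝓝 0) := by
    have h := tendsto_fst.comp hl'
    exact h
  have hl3 : Tendsto (fun p : V × q.domain => E (p.1 - (p.2 : V))) l (𝓝 0) := by
    have h := tendsto_snd.comp hl'
    exact h
  -- Such pairs exist because `D(q)` is dense in `D(E)` for the form topology.
  have : l.NeBot := by
    refine comap_neBot_iff.2 fun t ht => ?_
    obtain ⟨A, hA, B, hB, hAB⟩ := mem_prod_iff.1 ht
    obtain ⟨u, hu⟩ := F.nonempty_of_mem (mem_map.1 hA)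
    obtain ⟨G, hG⟩ := hE.exists_approximation u.2
    have := hG.neBot
    have h1 : Tendsto (fun g => (u : V) - g) G (𝓝 0) := by
      simpa using (tendsto_const_nhds (x := (u : V))).sub
        (show Tendsto id G (𝓝 (u : V)) from hG.tendsto)
    have h2 : Tendsto (fun g => ((u : V) - g, E ((u : V) - g))) G (𝓝 0 ×ˢ 𝓝 0) :=
      h1.prodMk (hE.tendsto_sub hG)
    obtain ⟨g, hg1, hg2⟩ := G.nonempty_of_mem (inter_mem hG.domain_mem (h2 hB))
    exact ⟨(u, ⟨g, hg1⟩), hAB ⟨hu, hg2⟩⟩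
  have hG : q.IsApproximation τ f (map (fun p : V × q.domain => (p.2 : V)) l) := by
    refine isApproximation_map_iff.2 ⟨Eventually.of_forall fun p => p.2.2, ?_, ?_⟩
    · have h1 := hcauchy.comp (hl1.prodMap hl1)
      have h2 := hl3.comp (tendsto_fst (f := l) (g := l))
      have h3 := hl3.comp (tendsto_snd (f := l) (g := l))
      refine (E.tendsto_map_sub_zero h1 (E.tendsto_map_sub_zero h2 h3)).congr fun p => ?_
      refine Eq.trans ?_ (hE.eq_of_lt_top (p.1.2 - p.2.2).2)
      congr 1
      simp only [Prod.map_fst, Prod.map_snd]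
      abel
    · simpa using (hl1.mono_right hf).sub hl2
  have hfE : E f < ∞ := hE.lt_top hG
  refine ⟨⟨f, hfE⟩, (le_nhds_formTopology τ E _ F).2 ⟨hf, ?_⟩⟩
  have h1 : Tendsto (fun p : V × q.domain => E (f - p.1)) l (𝓝 0) := by
    have h := tendsto_map'_iff.1 (hE.tendsto_sub hG)
    refine (E.tendsto_map_sub_zero h hl3).congr fun p => ?_
    congr 1
    abel
  -- Convergence to `f` is known only along `l`; the Cauchy property of `F'` transfers it to `F'`
  -- itself.
  have h2 : Tendsto (fun p : V × (V × q.domain) => E (p.1 - f)) (F' ×ˢ l) (𝓝 0) := by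
    refine (E.tendsto_map_sub_zero (hcauchy.comp (tendsto_id.prodMap hl1))
      (h1.comp (tendsto_snd (f := F') (g := l)))).congr fun p => ?_
    simp only [Prod.map_fst, Prod.map_snd, id]
    rw [sub_sub_sub_cancel_right]
  have h3 := (tendsto_map'_iff (f := fun v => E (v - f)) (g := Prod.fst)).2 h2
  rw [map_fst_prod] at h3
  exact h3

end Approximation

end QForm

/-! ### Local convergence in measure: Hausdorffness and completeness -/

section LocalMeasure

variable {X : Type*} [MeasurableSpace X] {m : Measure X}

theorem integrableOn_min_abs_one {U : Set X} (hU : m U < ∞) {h : X → ℝ} (hh : Measurable h) :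
    IntegrableOn (fun x => min |h x| 1) U m := by
  refine Measure.integrableOn_of_bounded hU.ne
    (hh.abs.min measurable_const).aestronglyMeasurable (M := 1) ?_
  filter_upwards with x
  rw [Real.norm_eq_abs, abs_of_nonneg (le_min (abs_nonneg _) zero_le_one)]
  exact min_le_right _ _

theorem measurable_coe (f : X →ₘ[m] ℝ) : Measurable f := f.stronglyMeasurable.measurable

theorem integrableOn_localDist {U : Set X} (hU : m U < ∞) (f g : X →ₘ[m] ℝ) :
    IntegrableOn (fun x => min |f x - g x| 1) U m :=
  integrableOn_min_abs_one hU ((measurable_coe f).sub (measurable_coe g))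

theorem min_abs_add_le (a b : ℝ) : min |a + b| 1 ≤ min |a| 1 + min |b| 1 := by
  have := abs_add_le a b
  rcases min_cases |a| 1 with h | h <;> rcases min_cases |b| 1 with h' | h' <;>
    rw [h.1, h'.1] <;>
    first
      | exact (min_le_left _ _).trans (by linarith)
      | exact (min_le_right _ _).trans (by linarith [abs_nonneg a, abs_nonneg b])

theorem localDist_nonneg (U : Set X) (f g : X →ₘ[m] ℝ) : 0 ≤ localDist m U f g :=
  integral_nonneg fun _ => le_min (abs_nonneg _) zero_le_one

theorem localDist_self (U : Set X) (f : X →ₘ[m] ℝ) : localDist m U f f = 0 := by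
  simp [localDist]

theorem localDist_comm (U : Set X) (f g : X →ₘ[m] ℝ) : localDist m U f g = localDist m U g f := by
  simp only [localDist, abs_sub_comm]

theorem localDist_triangle {U : Set X} (hU : m U < ∞) (f g h : X →ₘ[m] ℝ) :
    localDist m U f h ≤ localDist m U f g + localDist m U g h := by
  rw [localDist, localDist, localDist, ← integral_add (integrableOn_localDist hU f g)
    (integrableOn_localDist hU g h)]
  refine integral_mono (integrableOn_localDist hU f h)
    ((integrableOn_localDist hU f g).add (integrableOn_localDist hU g h))
    fun x => ?_
  have := min_abs_add_le (f x - g x) (g x - h x)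
  rwa [sub_add_sub_cancel] at this

theorem localDist_add_add_le {U : Set X} (hU : m U < ∞) (f g f' g' : X →ₘ[m] ℝ) :
    localDist m U (f + g) (f' + g') ≤ localDist m U f f' + localDist m U g g' := by
  rw [localDist, localDist, localDist, ← integral_add (integrableOn_localDist hU f f')
    (integrableOn_localDist hU g g')]
  refine integral_mono_ae
    (integrableOn_localDist hU (f + g) (f' + g'))
    ((integrableOn_localDist hU f f').add (integrableOn_localDist hU g g')) ?_
  filter_upwards [ae_restrict_of_ae (AEEqFun.coeFn_add f g),
    ae_restrict_of_ae (AEEqFun.coeFn_add f' g')] with x h1 h2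
  have := min_abs_add_le (f x - f' x) (g x - g' x)
  simp only [h1, h2, Pi.add_apply]
  rwa [add_sub_add_comm]

theorem localDist_smul_le {U : Set X} (hU : m U < ∞) (c : ℝ) (f g : X →ₘ[m] ℝ) :
    localDist m U (c • f) (c • g) ≤ max |c| 1 * localDist m U f g := by
  rw [localDist, localDist, ← integral_const_mul]
  refine integral_mono_ae
    (integrableOn_localDist hU (c • f) (c • g))
    ((integrableOn_localDist hU f g).const_mul _) ?_
  filter_upwards [ae_restrict_of_ae (AEEqFun.coeFn_smul c f),
    ae_restrict_of_ae (AEEqFun.coeFn_smul c g)] with x h1 h2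
  simp only [h1, h2, Pi.smul_apply, smul_eq_mul, ← mul_sub, abs_mul]
  rw [mul_min_of_nonneg _ _ (le_max_of_le_right zero_le_one)]
  exact min_le_min (mul_le_mul_of_nonneg_right (le_max_left _ _) (abs_nonneg _))
    (by rw [mul_one]; exact le_max_right _ _)

theorem localDist_sub_zero (U : Set X) (f g : X →ₘ[m] ℝ) :
    localDist m U (f - g) 0 = localDist m U f g := by
  refine integral_congr_ae ?_
  filter_upwards [ae_restrict_of_ae (AEEqFun.coeFn_sub f g),
    ae_restrict_of_ae (AEEqFun.coeFn_zero (α := X) (β := ℝ) (μ := m))] with x h1 h2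
  simp only [h1, h2, Pi.sub_apply, Pi.zero_apply, sub_zero]

theorem localDist_mono {U V : Set X} (hV : m V < ∞) (hUV : U ⊆ V)
    (f g : X →ₘ[m] ℝ) : localDist m U f g ≤ localDist m V f g :=
  setIntegral_mono_set (integrableOn_localDist hV f g)
    (Eventually.of_forall fun _ => le_min (abs_nonneg _) zero_le_one) hUV.eventuallyLE

theorem ae_eq_of_localDist_eq_zero {U : Set X} (hU : m U < ∞) {f g : X →ₘ[m] ℝ}
    (h : localDist m U f g = 0) : ∀ᵐ x ∂m.restrict U, f x = g x := by
  rw [localDist, integral_eq_zero_iff_of_nonneg (fun _ => le_min (abs_nonneg _) zero_le_one)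
    (integrableOn_localDist hU f g)] at h
  filter_upwards [h] with x hx
  rcases min_choice |f x - g x| 1 with h' | h'
  · exact sub_eq_zero.1 (abs_eq_zero.1 (h'.symm.trans hx))
  · exact absurd (h'.symm.trans hx) one_ne_zero

theorem le_nhds_localMeasureTopology (a : X →ₘ[m] ℝ) (F : Filter (X →ₘ[m] ℝ)) :
    F ≤ @nhds _ (localMeasureTopology m) a ↔ ∀ U : Set X, MeasurableSet U → m U < ∞ →
      Tendsto (fun f => localDist m U f a) F (𝓝 0) := by
  rw [le_nhds_generateFrom_balls (ι := {U : Set X // MeasurableSet U ∧ m U < ∞})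
    (d := fun U => localDist m U) (fun B => ?_) (fun U => localDist_nonneg _)
    (fun U => localDist_self _) (fun U => localDist_triangle U.2.2)]
  · exact ⟨fun h U h1 h2 => h ⟨U, h1, h2⟩, fun h U => h U.1 U.2.1 U.2.2⟩
  · constructor
    · rintro ⟨U, g, r, h1, h2, h3, h4⟩
      exact ⟨⟨U, h1, h2⟩, g, r, h3, h4⟩
    · rintro ⟨⟨U, h1, h2⟩, g, r, h3, h4⟩
      exact ⟨U, g, r, h1, h2, h3, h4⟩

theorem isTopologicalAddGroup_localMeasureTopology (m : Measure X) :
    @IsTopologicalAddGroup (X →ₘ[m] ℝ) (localMeasureTopology m) _ := by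
  let _ := localMeasureTopology m
  refine @IsTopologicalAddGroup.mk _ _ _ ⟨?_⟩ ⟨?_⟩
  · refine continuous_iff_continuousAt.2 fun p => ?_
    refine (le_nhds_localMeasureTopology _ _).2 fun U hU hU' => tendsto_map'_iff.2 ?_
    have h1 := (le_nhds_localMeasureTopology _ _).1 (continuous_fst.tendsto p) U hU hU'
    have h2 := (le_nhds_localMeasureTopology _ _).1 (continuous_snd.tendsto p) U hU hU'
    refine squeeze_zero (fun _ => localDist_nonneg _ _ _)
      (fun x => localDist_add_add_le hU' x.1 x.2 p.1 p.2) ?_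
    simpa using (tendsto_map'_iff.1 h1).add (tendsto_map'_iff.1 h2)
  · refine continuous_iff_continuousAt.2 fun f => ?_
    refine (le_nhds_localMeasureTopology _ _).2 fun U hU hU' => tendsto_map'_iff.2 ?_
    have h1 := (le_nhds_localMeasureTopology f _).1 le_rfl U hU hU'
    refine squeeze_zero (fun _ => localDist_nonneg _ _ _) (fun g => ?_) h1
    simpa using localDist_smul_le hU' (-1) g f

theorem continuousConstSMul_localMeasureTopology (m : Measure X) :
    @ContinuousConstSMul ℝ (X →ₘ[m] ℝ) (localMeasureTopology m) _ := by
  let _ := localMeasureTopology m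
  refine ⟨fun c => continuous_iff_continuousAt.2 fun f => ?_⟩
  refine (le_nhds_localMeasureTopology _ _).2 fun U hU hU' => tendsto_map'_iff.2 ?_
  have h1 := (le_nhds_localMeasureTopology f _).1 le_rfl U hU hU'
  refine squeeze_zero (fun _ => localDist_nonneg _ _ _) (fun g => localDist_smul_le hU' c g f) ?_
  simpa using h1.const_mul (max |c| 1)

/-- Non-separated classes agree a.e. on each set of finite measure. If `{f ≠ g}` had infinite
measure, semi-finiteness would give a subset of positive finite measure, a contradiction. -/
theorem t2Space_localMeasureTopology (hm : IsSemiFinite m) :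
    @T2Space (X →ₘ[m] ℝ) (localMeasureTopology m) := by
  let _ := localMeasureTopology m
  refine t2_iff_nhds.2 fun {f g} hfg => ?_
  have hd : ∀ U : Set X, MeasurableSet U → m U < ∞ → ∀ᵐ x ∂m.restrict U, f x = g x := by
    intro U hU hU'
    refine ae_eq_of_localDist_eq_zero hU' ?_
    have h1 := (le_nhds_localMeasureTopology f (𝓝 f ⊓ 𝓝 g)).1 inf_le_left U hU hU'
    have h2 := (le_nhds_localMeasureTopology g (𝓝 f ⊓ 𝓝 g)).1 inf_le_right U hU hU'
    refine le_antisymm (ge_of_tendsto' (by simpa using h1.add h2) fun h => ?_)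
      (localDist_nonneg _ _ _)
    rw [localDist_comm U h f]
    exact localDist_triangle hU' f h g
  have hA : MeasurableSet {x | f x ≠ g x} :=
    (measurableSet_eq_fun (measurable_coe f) (measurable_coe g)).compl
  have key : ∀ U ⊆ {x | f x ≠ g x}, MeasurableSet U → m U < ∞ → m U = 0 := by
    intro U hUA hU hU'
    have h := ae_iff.1 ((ae_restrict_iff' hU).1 (hd U hU hU'))
    refine measure_mono_null (fun x hx => ?_) h
    simpa using ⟨hx, hUA hx⟩
  refine AEEqFun.ext (ae_iff.2 ?_)
  by_cases hfin : m {x | f x ≠ g x} = ∞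
  · obtain ⟨A', h1, h2, h3, h4⟩ := hm _ hA hfin
    exact absurd (key A' h1 h2 h4) h3.ne'
  · exact key _ subset_rfl hA (lt_top_iff_ne_top.2 hfin)

/-- Cauchy filters for the pseudometric `d_U` converge. -/
theorem exists_tendsto_localDist {U : Set X} (hU' : m U < ∞)
    {F : Filter (X →ₘ[m] ℝ)} [F.NeBot]
    (hF : Tendsto (fun p : (X →ₘ[m] ℝ) × (X →ₘ[m] ℝ) => localDist m U p.1 p.2) (F ×ˢ F) (𝓝 0)) :
    ∃ g : X →ₘ[m] ℝ, Tendsto (fun f => localDist m U f g) F (𝓝 0) := by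
  -- A single pseudometric reduces the filter to a sequence with geometrically decaying increments,
  -- which converges a.e. on `U`.
  have hex : ∀ n : ℕ, ∃ u : X →ₘ[m] ℝ, ∀ᶠ f in F, localDist m U u f < (1 / 2 : ℝ) ^ n := fun n =>
    ((hF.eventually (gt_mem_nhds (by positivity))).curry).exists
  choose u hu using hex
  have hd : ∀ n, localDist m U (u n) (u (n + 1)) ≤ 2 * (1 / 2 : ℝ) ^ n := by
    intro n
    obtain ⟨f, h1, h2⟩ := ((hu n).and (hu (n + 1))).exists
    have h3 := localDist_triangle hU' (u n) f (u (n + 1))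
    rw [localDist_comm U f] at h3
    have h4 : (1 / 2 : ℝ) ^ (n + 1) ≤ (1 / 2 : ℝ) ^ n :=
      pow_le_pow_of_le_one (by norm_num) (by norm_num) n.le_succ
    linarith
  have hmeas : ∀ n, Measurable fun x => u n x - u (n + 1) x := fun n =>
    (measurable_coe _).sub (measurable_coe _)
  have hlim : ∀ᵐ x ∂m.restrict U, ∃ l : ℝ, Tendsto (fun n => u n x) atTop (𝓝 l) := by
    have hsum : ∫⁻ x in U, ∑' n, ENNReal.ofReal (min |u n x - u (n + 1) x| 1) ∂m ≠ ∞ := by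
      rw [lintegral_tsum fun n =>
        ((hmeas n).abs.min measurable_const).ennreal_ofReal.aemeasurable]
      have h1 : ∀ n, ∫⁻ x in U, ENNReal.ofReal (min |u n x - u (n + 1) x| 1) ∂m ≤
          ENNReal.ofReal (2 * (1 / 2 : ℝ) ^ n) := by
        intro n
        rw [← ofReal_integral_eq_lintegral_ofReal (integrableOn_min_abs_one hU' (hmeas n))
          (Eventually.of_forall fun _ => le_min (abs_nonneg _) zero_le_one)]
        exact ENNReal.ofReal_le_ofReal (hd n)
      refine ne_top_of_le_ne_top ?_ (ENNReal.tsum_le_tsum h1)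
      exact (summable_geometric_two.mul_left 2).tsum_ofReal_ne_top
    filter_upwards [ae_lt_top' (AEMeasurable.tsum fun n =>
      ((hmeas n).abs.min measurable_const).ennreal_ofReal.aemeasurable) hsum] with x hx
    have h1 : Summable fun n => min |u n x - u (n + 1) x| 1 := by
      refine (ENNReal.summable_toReal hx.ne).congr fun n => ?_
      exact ENNReal.toReal_ofReal (le_min (abs_nonneg _) zero_le_one)
    have h2 : Summable fun n => dist (u n x) (u (n + 1) x) := by
      -- Summable terms are eventually below `1`, where the truncation by `1` is inactive.
      refine h1.of_norm_bounded_eventually_nat ?_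
      filter_upwards [h1.tendsto_atTop_zero.eventually (gt_mem_nhds one_pos)] with n hn
      have h3 := (min_lt_iff.1 hn).resolve_right (lt_irrefl _)
      rw [min_eq_left h3.le, Real.dist_eq, Real.norm_eq_abs, abs_abs]
    exact cauchySeq_tendsto_of_complete (cauchySeq_of_summable_dist h2)
  obtain ⟨g, hg, hgl⟩ := exists_stronglyMeasurable_limit_of_tendsto_ae
    (fun n => (u n).stronglyMeasurable.aestronglyMeasurable) hlim
  set g' : X →ₘ[m] ℝ := AEEqFun.mk g hg.aestronglyMeasurable
  have hug : Tendsto (fun n => localDist m U (u n) g') atTop (𝓝 0) := by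
    have h1 := tendsto_integral_of_dominated_convergence (μ := m.restrict U) (F := fun n x =>
      min |u n x - g' x| 1) (f := fun _ => 0) (fun _ => 1)
      (fun n => (((measurable_coe _).sub (measurable_coe _)).abs.min
        measurable_const).aestronglyMeasurable) (integrableOn_const hU'.ne)
      (fun n => Eventually.of_forall fun x => by
        rw [Real.norm_eq_abs, abs_of_nonneg (le_min (abs_nonneg _) zero_le_one)]
        exact min_le_right _ _) ?_
    · simpa [localDist] using h1
    · filter_upwards [hgl, ae_restrict_of_ae (AEEqFun.coeFn_mk g hg.aestronglyMeasurable)]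
        with x hx hx'
      have h2 := ((hx.sub_const (g x)).abs).min (tendsto_const_nhds (x := (1 : ℝ)))
      rw [sub_self, abs_zero, min_eq_left zero_le_one] at h2
      rw [hx']
      exact h2
  refine ⟨g', ?_⟩
  rw [Metric.tendsto_nhds]
  intro ε hε
  obtain ⟨n, hn1, hn2⟩ := ((hug.eventually (gt_mem_nhds (half_pos hε))).and
    ((tendsto_pow_atTop_nhds_zero_of_lt_one (r := (1 / 2 : ℝ)) (by norm_num)
      (by norm_num)).eventually (gt_mem_nhds (half_pos hε)))).exists
  filter_upwards [hu n] with f hf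
  rw [Real.dist_0_eq_abs, abs_of_nonneg (localDist_nonneg _ _ _)]
  have := localDist_triangle hU' f (u n) g'
  rw [localDist_comm U f (u n)] at this
  linarith

/-- On a localizable measure space, functions given on the sets of finite measure that agree
almost everywhere on overlaps can be glued together. -/
theorem IsLocalizable.exists_glue (hm : IsLocalizable m) (f : Set X → X →ₘ[m] ℝ)
    (hf : ∀ U V : Set X, MeasurableSet U → m U < ∞ → MeasurableSet V → m V < ∞ →
      ∀ᵐ x ∂m.restrict (U ∩ V), f U x = f V x) :
    ∃ g : X →ₘ[m] ℝ, ∀ U : Set X, MeasurableSet U → m U < ∞ → ∀ᵐ x ∂m.restrict U, g x = f U x := by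
  have hlt : ∀ (q : ℚ) (U : Set X), MeasurableSet {x | (q : ℝ) < f U x} := fun q U =>
    measurableSet_lt measurable_const (measurable_coe _)
  -- The essential supremum `S` of the local level sets `U ∩ {f_U > q}` serves as a global level
  -- set.
  have hS : ∀ q : ℚ, ∃ S : Set X, MeasurableSet S ∧
      ∀ U : Set X, MeasurableSet U → m U < ∞ → ∀ᵐ x ∂m.restrict U, x ∈ S ↔ (q : ℝ) < f U x := by
    intro q
    obtain ⟨S, hS, hS1, hS2⟩ := hm.2 {A | ∃ U, MeasurableSet U ∧ m U < ∞ ∧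
      A = U ∩ {x | (q : ℝ) < f U x}} (by
        rintro A ⟨U, hU, -, rfl⟩
        exact hU.inter (hlt q U))
    refine ⟨S, hS, fun U hU hU' => ?_⟩
    have h1 := hS1 _ ⟨U, hU, hU', rfl⟩
    -- By compatibility this test set contains all local level sets up to null sets. Minimality of
    -- `S` then gives `S ∩ U ⊆ {f_U > q}` a.e.
    have h2 := hS2 ((U ∩ {x | (q : ℝ) < f U x}) ∪ Uᶜ) ((hU.inter (hlt q U)).union hU.compl) (by
      rintro A ⟨V, hV, hV', rfl⟩
      refine measure_mono_null (fun x hx => ?_)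
        (ae_iff.1 ((ae_restrict_iff' (hU.inter hV)).1 (hf U V hU hU' hV hV')))
      simp only [Set.mem_sdiff, Set.mem_inter_iff, Set.mem_ofPred_eq, Set.mem_union,
        Set.mem_compl_iff, not_or, not_and, not_not] at hx ⊢
      obtain ⟨⟨hxV, hqV⟩, hx1, hxU⟩ := hx
      simp only [Classical.not_imp]
      exact ⟨⟨hxU, hxV⟩, fun h => hx1 hxU (h ▸ hqV)⟩)
    rw [ae_restrict_iff' hU]
    filter_upwards [measure_eq_zero_iff_ae_notMem.1 h1, measure_eq_zero_iff_ae_notMem.1 h2]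
      with x hx1 hx2 hxU
    simp only [Set.mem_sdiff, Set.mem_inter_iff, Set.mem_ofPred_eq, Set.mem_union,
      Set.mem_compl_iff, not_and, not_not] at hx1 hx2
    exact ⟨fun h => ((hx2 h).resolve_right (by simpa using hxU)).2, fun h => hx1 ⟨hxU, h⟩⟩
  choose S hSm hS using hS
  classical
  -- The function is recovered from its rational level sets; extended values absorb points where
  -- these are empty or unbounded.
  let g : X → EReal := fun x => ⨆ q : ℚ, if x ∈ S q then ((q : ℝ) : EReal) else ⊥
  have hg : Measurable fun x => (g x).toReal :=
    (Measurable.iSup fun q => Measurable.ite (hSm q) measurable_const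
      measurable_const).ereal_toReal
  refine ⟨AEEqFun.mk _ hg.aestronglyMeasurable, fun U hU hU' => ?_⟩
  filter_upwards [ae_restrict_of_ae (AEEqFun.coeFn_mk _ hg.aestronglyMeasurable),
    ae_all_iff.2 fun q => hS q U hU hU'] with x hx hxS
  rw [hx]
  have : g x = (f U x : EReal) := by
    refine le_antisymm (iSup_le fun q => ?_) (le_of_forall_lt fun c hc => ?_)
    · split_ifs with h
      · exact EReal.coe_le_coe_iff.2 ((hxS q).1 h).le
      · exact bot_le
    · obtain ⟨q, hq1, hq2⟩ := EReal.lt_iff_exists_rat_btwn.1 hc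
      refine hq1.trans_le (le_iSup_of_le q ?_)
      rw [if_pos ((hxS q).2 (EReal.coe_lt_coe_iff.1 hq2))]
  rw [this, EReal.toReal_coe]

/-- Limits on the individual sets of finite measure agree on overlaps by uniqueness, so they can be
glued. -/
theorem isCompleteVectorTopology_localMeasureTopology (hm : IsLocalizable m) :
    IsCompleteVectorTopology (localMeasureTopology m) := by
  intro F hF hC
  have hC' : ∀ U, MeasurableSet U → m U < ∞ →
      Tendsto (fun p : (X →ₘ[m] ℝ) × (X →ₘ[m] ℝ) => localDist m U p.1 p.2) (F ×ˢ F) (𝓝 0) := by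
    intro U hU hU'
    have h := tendsto_map'_iff.1 ((le_nhds_localMeasureTopology 0 _).1 hC U hU hU')
    exact h.congr fun p => localDist_sub_zero U p.1 p.2
  have hex : ∀ U : Set X, ∃ g : X →ₘ[m] ℝ, MeasurableSet U → m U < ∞ →
      Tendsto (fun f => localDist m U f g) F (𝓝 0) := by
    intro U
    by_cases h : MeasurableSet U ∧ m U < ∞
    · obtain ⟨g, hg⟩ := exists_tendsto_localDist h.2 (hC' U h.1 h.2)
      exact ⟨g, fun _ _ => hg⟩
    · exact ⟨0, fun h1 h2 => (h ⟨h1, h2⟩).elim⟩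
  choose f hf using hex
  obtain ⟨g, hg⟩ := hm.exists_glue f (by
    intro U V hU hU' hV hV'
    have hUV : m (U ∩ V) < ∞ := (measure_mono Set.inter_subset_left).trans_lt hU'
    refine ae_eq_of_localDist_eq_zero hUV ?_
    refine le_antisymm (ge_of_tendsto' (by simpa using (hf U hU hU').add (hf V hV hV'))
      fun h => ?_) (localDist_nonneg _ _ _)
    have h1 := localDist_triangle hUV (f U) h (f V)
    rw [localDist_comm _ (f U) h] at h1
    exact h1.trans (add_le_add (localDist_mono hU' Set.inter_subset_left _ _)
      (localDist_mono hV' Set.inter_subset_right _ _)))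
  refine ⟨g, (le_nhds_localMeasureTopology g F).2 fun U hU hU' => ?_⟩
  refine (hf U hU hU').congr fun h => integral_congr_ae ?_
  filter_upwards [hg U hU hU'] with x hx
  rw [hx]

end LocalMeasure

/-! ### Integrability and convergence of weighted integrals -/

section Integrals

variable {X : Type*} [MeasurableSpace X] {m : Measure X}

/-- A nonnegative `L²`-function whose integrals over sets of finite measure are bounded is
integrable. -/
theorem integrable_of_setIntegral_le (g : Lp ℝ 2 m) (hg : 0 ≤ᵐ[m] g) {C : ℝ}
    (hC : ∀ U : Set X, MeasurableSet U → m U < ∞ → ∫ x in U, g x ∂m ≤ C) : Integrable g m := by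
  have hmeas : Measurable g := (Lp.stronglyMeasurable g).measurable
  refine ⟨hmeas.aestronglyMeasurable, (hasFiniteIntegral_iff_ofReal hg).2 ?_⟩
  -- These level sets have finite measure since `g ∈ L²`, and they exhaust `{g > 0}`.
  let V : ℕ → Set X := fun n => {x | (1 / (n + 1) : ℝ) ≤ g x}
  have hV : ∀ n, MeasurableSet (V n) := fun n => measurableSet_le measurable_const hmeas
  have hVfin : ∀ n, m (V n) < ∞ := by
    intro n
    have hn : (0 : ℝ) < 1 / (n + 1) := by positivity
    refine (measure_mono fun x hx => ?_).trans_lt ((Lp.memLp g).meas_ge_lt_top (by simp) (by simp)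
      (Real.toNNReal_pos.2 hn).ne')
    refine Real.toNNReal_le_iff_le_coe.2 (le_trans hx ?_)
    rw [coe_nnnorm]
    exact Real.le_norm_self _
  have hVmono : Monotone V := by
    intro a b hab x hx
    have hx' : (1 / (a + 1) : ℝ) ≤ g x := hx
    exact (Nat.one_div_le_one_div hab).trans hx'
  have hbound : ∀ n, ∫⁻ x in V n, ENNReal.ofReal (g x) ∂m ≤ ENNReal.ofReal C := by
    intro n
    rw [← ofReal_integral_eq_lintegral_ofReal
      (integrableOn_Lp_of_measure_ne_top g one_le_two (hVfin n).ne) (ae_restrict_of_ae hg)]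
    exact ENNReal.ofReal_le_ofReal (hC _ (hV n) (hVfin n))
  have hunion : ∫⁻ x, ENNReal.ofReal (g x) ∂m = ∫⁻ x in ⋃ n, V n, ENNReal.ofReal (g x) ∂m := by
    rw [← lintegral_indicator (MeasurableSet.iUnion hV)]
    refine lintegral_congr fun x => ?_
    by_cases hx : x ∈ ⋃ n, V n
    · rw [Set.indicator_of_mem hx]
    · rw [Set.indicator_of_notMem hx, ENNReal.ofReal_eq_zero]
      by_contra hpos
      obtain ⟨n, hn⟩ := exists_nat_one_div_lt (not_le.1 hpos)
      exact hx (Set.mem_iUnion.2 ⟨n, hn.le⟩)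
  rw [hunion, setLIntegral_iUnion_of_directed _ hVmono.directed_le]
  exact (iSup_le hbound).trans_lt ENNReal.ofReal_lt_top

/-- Local convergence in measure implies convergence of integrals with integrable weights. -/
theorem tendsto_integral_min_mul {α : Type*} {l : Filter α} {f : α → X →ₘ[m] ℝ} {f₀ : X →ₘ[m] ℝ}
    (hf : ∀ U : Set X, MeasurableSet U → m U < ∞ →
      Tendsto (fun i => localDist m U (f i) f₀) l (𝓝 0))
    {φ : X → ℝ} (hφm : Measurable φ) (hφ : Integrable φ m) :
    Tendsto (fun i => ∫ x, min |f i x - f₀ x| 1 * |φ x| ∂m) l (𝓝 0) := by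
  -- On `A n`, of finite measure, the weight is at most `n` and the local pseudometric applies; off
  -- it the integral of `|φ|` tends to `0`.
  let A : ℕ → Set X := fun n => {x | (1 / (n + 1) : ℝ) ≤ |φ x|} ∩ {x | |φ x| ≤ n}
  have hA : ∀ n, MeasurableSet (A n) := fun n =>
    (measurableSet_le measurable_const hφm.abs).inter (measurableSet_le hφm.abs measurable_const)
  have hAfin : ∀ n, m (A n) < ∞ := fun n =>
    (measure_mono Set.inter_subset_left).trans_lt
      (hφ.measure_norm_ge_lt_top (ε := 1 / (n + 1)) (by positivity))
  have hrest : Tendsto (fun n => ∫ x, (A n)ᶜ.indicator (fun x => |φ x|) x ∂m) atTop (𝓝 0) := by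
    rw [← integral_zero X ℝ (μ := m)]
    refine tendsto_integral_of_dominated_convergence (fun x => |φ x|)
      (fun n => (hφm.abs.indicator (hA n).compl).aestronglyMeasurable) hφ.abs
      (fun n => Eventually.of_forall fun x => ?_) (Eventually.of_forall fun x => ?_)
    · refine (norm_indicator_le_norm_self _ _).trans ?_
      simp
    · by_cases hx : φ x = 0
      · refine tendsto_const_nhds.congr fun n => ?_
        by_cases h : x ∈ (A n)ᶜ
        · rw [Set.indicator_of_mem h, hx, abs_zero]
        · rw [Set.indicator_of_notMem h]
      · refine tendsto_const_nhds.congr' ?_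
        have h1 : ∀ᶠ n : ℕ in atTop, (1 / (n + 1) : ℝ) < |φ x| :=
          tendsto_one_div_add_atTop_nhds_zero_nat.eventually (gt_mem_nhds (abs_pos.2 hx))
        have h2 : ∀ᶠ n : ℕ in atTop, |φ x| ≤ n :=
          tendsto_natCast_atTop_atTop.eventually_ge_atTop |φ x|
        filter_upwards [h1, h2] with n hn1 hn2
        have hxA : x ∈ A n := ⟨hn1.le, hn2⟩
        exact (Set.indicator_of_notMem (Set.notMem_compl_iff.2 hxA) _).symm
  have hint : ∀ i, Integrable (fun x => min |f i x - f₀ x| 1 * |φ x|) m := by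
    intro i
    refine hφ.abs.mono' ?_ (Eventually.of_forall fun x => ?_)
    · exact ((((measurable_coe _).sub (measurable_coe _)).abs.min measurable_const).mul
        hφm.abs).aestronglyMeasurable
    · rw [norm_mul, Real.norm_eq_abs, Real.norm_eq_abs, abs_abs,
        abs_of_nonneg (le_min (abs_nonneg _) zero_le_one)]
      exact mul_le_of_le_one_left (abs_nonneg _) (min_le_right _ _)
  have hle : ∀ n i, ∫ x, min |f i x - f₀ x| 1 * |φ x| ∂m ≤
      n * localDist m (A n) (f i) f₀ + ∫ x, (A n)ᶜ.indicator (fun x => |φ x|) x ∂m := by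
    intro n i
    have hd := integrableOn_localDist (hAfin n) (f i) f₀
    rw [localDist, ← integral_indicator (hA n), ← integral_const_mul, ← integral_add
      ((hd.integrable_indicator (hA n)).const_mul _) (hφ.abs.indicator (hA n).compl)]
    refine integral_mono (hint i) (((hd.integrable_indicator (hA n)).const_mul _).add
      (hφ.abs.indicator (hA n).compl)) fun x => ?_
    have h0 : 0 ≤ min |f i x - f₀ x| 1 := le_min (abs_nonneg _) zero_le_one
    by_cases hx : x ∈ A n
    · simp only [Set.indicator_of_mem hx, Set.indicator_of_notMem (Set.notMem_compl_iff.2 hx),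
        add_zero]
      rw [mul_comm]
      exact mul_le_mul_of_nonneg_right hx.2 h0
    · simp only [Set.indicator_of_notMem hx, Set.indicator_of_mem (Set.mem_compl hx), mul_zero,
        zero_add]
      exact mul_le_of_le_one_left (abs_nonneg _) (min_le_right _ _)
  rw [Metric.tendsto_nhds]
  intro ε hε
  obtain ⟨n, hn⟩ := (hrest.eventually (gt_mem_nhds (half_pos hε))).exists
  have h1 := (hf (A n) (hA n) (hAfin n)).const_mul (n : ℝ)
  rw [mul_zero] at h1
  filter_upwards [h1.eventually (gt_mem_nhds (half_pos hε))] with i hi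
  rw [Real.dist_0_eq_abs, abs_of_nonneg (integral_nonneg fun x =>
    mul_nonneg (le_min (abs_nonneg _) zero_le_one) (abs_nonneg _))]
  linarith [hle n i]

/-- For bounded Lipschitz functions `T`, the integrals of `T ∘ f` against an integrable function
depend continuously on `f` with respect to local convergence in measure. -/
theorem tendsto_integral_comp_mul {α : Type*} {l : Filter α} {f : α → X →ₘ[m] ℝ}
    {f₀ : X →ₘ[m] ℝ}
    (hf : ∀ U : Set X, MeasurableSet U → m U < ∞ →
      Tendsto (fun i => localDist m U (f i) f₀) l (𝓝 0))
    {φ : X → ℝ} (hφm : Measurable φ) (hφ : Integrable φ m) {T : ℝ → ℝ} (hT : Continuous T)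
    {L M : ℝ} (hL : ∀ s t, |T s - T t| ≤ L * |s - t|) (hM : ∀ t, |T t| ≤ M) :
    Tendsto (fun i => ∫ x, T (f i x) * φ x ∂m) l (𝓝 (∫ x, T (f₀ x) * φ x ∂m)) := by
  have hint : ∀ g : X →ₘ[m] ℝ, Integrable (fun x => T (g x) * φ x) m := fun g =>
    hφ.bdd_mul (hT.measurable.comp (measurable_coe g)).aestronglyMeasurable
      (Eventually.of_forall fun x => hM _)
  have hM0 : 0 ≤ M := (abs_nonneg _).trans (hM 0)
  have hmax : 0 ≤ max L (2 * M) := le_max_of_le_right (by positivity)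
  -- The Lipschitz bound serves for `|s - t| ≤ 1`, the sup bound otherwise.
  have hpt : ∀ s t, |T s - T t| ≤ max L (2 * M) * min |s - t| 1 := by
    intro s t
    rcases min_choice |s - t| 1 with h | h
    · rw [h]
      exact (hL s t).trans (mul_le_mul_of_nonneg_right (le_max_left _ _) (abs_nonneg _))
    · rw [h, mul_one]
      refine ((abs_sub _ _).trans ?_).trans (le_max_right _ _)
      linarith [hM s, hM t]
  rw [tendsto_iff_dist_tendsto_zero]
  have h0 := (tendsto_integral_min_mul hf hφm hφ).const_mul (max L (2 * M))
  rw [mul_zero] at h0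
  refine squeeze_zero (fun _ => dist_nonneg) (fun i => ?_) h0
  rw [Real.dist_eq, ← integral_sub (hint _) (hint _), ← integral_const_mul]
  refine (abs_integral_le_integral_abs).trans (integral_mono ((hint _).sub (hint _)).abs ?_ ?_)
  · refine Integrable.const_mul ?_ _
    refine hφ.abs.mono' ?_ (Eventually.of_forall fun x => ?_)
    · exact ((((measurable_coe _).sub (measurable_coe _)).abs.min measurable_const).mul
        hφm.abs).aestronglyMeasurable
    · rw [norm_mul, Real.norm_eq_abs, Real.norm_eq_abs, abs_abs,
        abs_of_nonneg (le_min (abs_nonneg _) zero_le_one)]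
      exact mul_le_of_le_one_left (abs_nonneg _) (min_le_right _ _)
  · intro x
    beta_reduce
    rw [← sub_mul, abs_mul, ← mul_assoc]
    exact mul_le_mul_of_nonneg_right (hpt _ _) (abs_nonneg _)

end Integrals

open scoped RealInnerProductSpace


/-! ### The Hilbert space of the form, resolvents of indicators, and a dense set of test vectors -/

section FormDomain

variable {X : Type*} [MeasurableSpace X] {m : Measure X}

/-- The domain of a form on `L²(m)`, to be equipped with the inner product `E + ⟪·, ·⟫`. -/
def FormDomain (E : QForm (Lp ℝ 2 m)) : Type _ := E.domain

namespace FormDomain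

variable {E : QForm (Lp ℝ 2 m)}

instance : AddCommGroup (FormDomain E) := inferInstanceAs (AddCommGroup E.domain)

instance : Module ℝ (FormDomain E) := inferInstanceAs (Module ℝ E.domain)

/-- The inclusion of the form domain into `L²(m)`. -/
def incl (E : QForm (Lp ℝ 2 m)) : FormDomain E →ₗ[ℝ] Lp ℝ 2 m := E.domain.subtype

theorem incl_injective : Function.Injective (incl E) := Subtype.val_injective

theorem map_incl_lt_top (u : FormDomain E) : E (incl E u) < ∞ := u.2

/-- The form as a real-valued map on its domain. -/
noncomputable def energy (u : FormDomain E) : ℝ := (E (incl E u)).toReal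

theorem isParallelogramForm_energy : IsParallelogramForm (energy : FormDomain E → ℝ) :=
  E.isParallelogramForm

theorem ofReal_energy (u : FormDomain E) : ENNReal.ofReal (energy u) = E (incl E u) :=
  ENNReal.ofReal_toReal (map_incl_lt_top u).ne

theorem energy_nonneg (u : FormDomain E) : 0 ≤ energy u := ENNReal.toReal_nonneg

/-- The bilinear form on the form domain. -/
noncomputable def form : FormDomain E →ₗ[ℝ] FormDomain E →ₗ[ℝ] ℝ :=
  isParallelogramForm_energy.bilin

theorem form_self (u : FormDomain E) : form u u = energy u :=
  isParallelogramForm_energy.bilin_self u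

theorem abs_form_le (u v : FormDomain E) : |form u v| ≤ √(energy u) * √(energy v) :=
  isParallelogramForm_energy.abs_bilin_le u v

/-- The inner product `E + ⟪·, ·⟫`. -/
@[reducible]
noncomputable def core : InnerProductSpace.Core ℝ (FormDomain E) where
  inner u v := form u v + ⟪incl E u, incl E v⟫
  conj_inner_symm u v := by
    simp only [conj_trivial]
    rw [real_inner_comm, show form v u = form u v from isParallelogramForm_energy.bilin_comm v u]
  re_inner_nonneg u := by
    rw [form_self]
    exact add_nonneg (energy_nonneg u) real_inner_self_nonneg
  add_left u v w := by
    simp only [map_add, LinearMap.add_apply, inner_add_left]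
    ring
  smul_left u v c := by
    simp only [map_smul, LinearMap.smul_apply, real_inner_smul_left, smul_eq_mul, conj_trivial]
    ring
  definite u hu := by
    rw [form_self] at hu
    have h : ⟪incl E u, incl E u⟫ = 0 := by
      linarith [energy_nonneg u, real_inner_self_nonneg (x := incl E u)]
    exact incl_injective ((inner_self_eq_zero.1 h).trans (map_zero _).symm)

noncomputable instance : NormedAddCommGroup (FormDomain E) := core.toNormedAddCommGroup

noncomputable instance : InnerProductSpace ℝ (FormDomain E) := InnerProductSpace.ofCore core.toCore

theorem inner_eq (u v : FormDomain E) : ⟪u, v⟫ = form u v + ⟪incl E u, incl E v⟫ := rfl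

theorem norm_sq_eq (u : FormDomain E) : ‖u‖ ^ 2 = energy u + ‖incl E u‖ ^ 2 := by
  rw [← real_inner_self_eq_norm_sq, inner_eq, form_self, real_inner_self_eq_norm_sq]

theorem norm_incl_le (u : FormDomain E) : ‖incl E u‖ ≤ ‖u‖ := by
  refine le_of_sq_le_sq ?_ (norm_nonneg u)
  rw [norm_sq_eq]
  linarith [energy_nonneg u]

/-- The inclusion of the form domain into `L²(m)` as a continuous map. -/
noncomputable def inclL (E : QForm (Lp ℝ 2 m)) : FormDomain E →L[ℝ] Lp ℝ 2 m :=
  (incl E).mkContinuous 1 fun u => by simpa using norm_incl_le u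

theorem inclL_apply (u : FormDomain E) : inclL E u = incl E u := rfl

theorem tendsto_norm_zero_iff {α : Type*} {l : Filter α} {f : α → FormDomain E} :
    Tendsto (fun i => ‖f i‖) l (𝓝 0) ↔ Tendsto (fun i => incl E (f i)) l (𝓝 0) ∧
      Tendsto (fun i => E (incl E (f i))) l (𝓝 0) := by
  constructor
  · intro h
    refine ⟨squeeze_zero_norm (fun i => norm_incl_le _) h, ?_⟩
    have h1 : Tendsto (fun i => energy (f i)) l (𝓝 0) := by
      refine squeeze_zero (fun i => energy_nonneg _) (fun i => ?_) (by simpa using h.pow 2)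
      rw [norm_sq_eq]
      exact le_add_of_nonneg_right (sq_nonneg _)
    simpa only [ofReal_energy, ENNReal.ofReal_zero] using ENNReal.tendsto_ofReal h1
  · rintro ⟨h1, h2⟩
    have h3 : Tendsto (fun i => ‖f i‖ ^ 2) l (𝓝 0) := by
      simp only [norm_sq_eq]
      simpa [energy] using ((ENNReal.tendsto_toReal ENNReal.zero_ne_top).comp h2).add (h1.norm.pow 2)
    simpa [Function.comp_def, Real.sqrt_sq] using (Real.continuous_sqrt.tendsto _).comp h3

/-- For the norm topology of `L²`, form convergence is convergence in the norm of `E + ⟪·, ·⟫`. -/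
theorem completeSpace (hE : E.IsClosedForm inferInstance) : CompleteSpace (FormDomain E) := by
  refine Metric.complete_of_cauchySeq_tendsto fun u hu => ?_
  have h1 : Tendsto (fun p : ℕ × ℕ => ‖u p.1 - u p.2‖) (atTop ×ˢ atTop) (𝓝 0) := by
    rw [prod_atTop_atTop_eq]
    simpa only [dist_eq_norm] using cauchySeq_iff_tendsto_dist_atTop_0.1 hu
  obtain ⟨h2, h3⟩ := tendsto_norm_zero_iff.1 h1
  let u' : ℕ → E.domain := u
  obtain ⟨x, hx⟩ := hE (map u' atTop) inferInstance (by
    refine (QForm.le_nhds_formTopology _ E 0 _).2 ?_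
    rw [prod_map_map_eq, tendsto_map'_iff, tendsto_map'_iff, tendsto_map'_iff, tendsto_map'_iff]
    refine ⟨h2, h3.congr fun p => ?_⟩
    exact congrArg E.toFun (sub_zero _).symm)
  obtain ⟨h4, h5⟩ := (QForm.le_nhds_formTopology _ E x _).1 hx
  rw [tendsto_map'_iff] at h4 h5
  let x' : FormDomain E := x
  refine ⟨x', tendsto_iff_norm_sub_tendsto_zero.2 (tendsto_norm_zero_iff.2 ⟨?_, h5⟩)⟩
  have h6 := h4.sub_const (x : Lp ℝ 2 m)
  rw [sub_self] at h6
  exact h6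

section Resolvent

variable [CompleteSpace (FormDomain E)]

/-- The `1`-resolvent of the form. -/
noncomputable def resolvent (E : QForm (Lp ℝ 2 m)) [CompleteSpace (FormDomain E)] :
    Lp ℝ 2 m →L[ℝ] FormDomain E :=
  ContinuousLinearMap.adjoint (inclL E)

theorem inner_resolvent (f : Lp ℝ 2 m) (v : FormDomain E) : ⟪resolvent E f, v⟫ = ⟪f, incl E v⟫ :=
  ContinuousLinearMap.adjoint_inner_left _ _ _

/-- If a normal contraction fixes `f` and reduces the form, then it fixes the resolvent of `f`. -/
theorem compLp_resolvent {C : ℝ → ℝ} (hC : LipschitzWith 1 C) (h0 : C 0 = 0)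
    (hCE : ∀ u : Lp ℝ 2 m, E (hC.compLp h0 u) ≤ E u) {f : Lp ℝ 2 m} (hf : hC.compLp h0 f = f) :
    hC.compLp h0 (incl E (resolvent E f)) = incl E (resolvent E f) := by
  set u := resolvent E f with hu
  let c : FormDomain E := ⟨hC.compLp h0 (incl E u), (hCE _).trans_lt (map_incl_lt_top u)⟩
  have hc : incl E c = hC.compLp h0 (incl E u) := rfl
  have hce : energy c ≤ energy u := ENNReal.toReal_mono (map_incl_lt_top u).ne (hCE _)
  have hdist : ‖incl E c - f‖ ≤ ‖incl E u - f‖ := by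
    have := hC.norm_compLp_sub_le h0 (incl E u) f
    rwa [hf, NNReal.coe_one, one_mul] at this
  have h1 : ‖incl E c - f‖ ^ 2 ≤ ‖incl E u - f‖ ^ 2 := by gcongr
  rw [norm_sub_sq_real, norm_sub_sq_real] at h1
  have h2 := norm_sub_sq_real c u
  have h3 : ⟪c, u⟫ = ⟪incl E c, f⟫ := by
    rw [real_inner_comm, hu, inner_resolvent, real_inner_comm]
  have h4 : ‖u‖ ^ 2 = ⟪incl E u, f⟫ := by
    rw [← real_inner_self_eq_norm_sq]
    conv_lhs => rw [hu, inner_resolvent]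
    rw [real_inner_comm]
  -- The resolvent is the unique minimiser of `E(v) + ‖v - f‖²`, and the excess of `c` over the
  -- minimum is exactly `‖c - u‖²` in the form norm.
  have h5 : ‖c - u‖ ^ 2 ≤ 0 := by
    rw [h2, h3, norm_sq_eq c]
    have := norm_sq_eq u
    linarith
  have h6 : c = u := by
    rw [← sub_eq_zero, ← norm_eq_zero]
    exact pow_eq_zero_iff two_ne_zero |>.1 (le_antisymm h5 (sq_nonneg _))
  rw [← hc, h6]

/-- Every cutoff fixes the indicator, hence also its resolvent, whose values thus lie in `[-ε, 1 +
ε]` for `ε = 1/(n + 1)`. -/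
theorem resolvent_indicator_mem_Icc (hE : IsMarkovian E) {U : Set X} (hU : MeasurableSet U)
    (hU' : m U ≠ ∞) :
    ∀ᵐ x ∂m, incl E (resolvent E (indicatorConstLp 2 hU hU' 1)) x ∈ Set.Icc (0 : ℝ) 1 := by
  set u := incl E (resolvent E (indicatorConstLp 2 hU hU' 1)) with hu
  have key : ∀ n : ℕ, ∀ᵐ x ∂m, u x ∈ Set.Icc (-(1 / (n + 1)) : ℝ) (1 + 1 / (n + 1)) := by
    intro n
    obtain ⟨C, hC, hCE⟩ := hE (1 / (n + 1)) (by positivity)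
    have h := compLp_resolvent hC.lipschitz hC.map_zero hCE
      (f := indicatorConstLp 2 hU hU' 1) (by
        refine Lp.ext ((hC.lipschitz.coeFn_compLp _ _).trans ?_)
        filter_upwards [indicatorConstLp_coeFn (p := 2) (hs := hU) (hμs := hU') (c := (1 : ℝ))]
          with x hx
        rw [Function.comp_apply, hx]
        by_cases hxU : x ∈ U
        · rw [Set.indicator_of_mem hxU, hC.eq_self 1 (by simp)]
        · rw [Set.indicator_of_notMem hxU, hC.map_zero])
    rw [← hu] at h
    have h' := hC.lipschitz.coeFn_compLp hC.map_zero u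
    rw [h] at h'
    filter_upwards [h'] with x hx
    rw [hx]
    exact hC.mem_Icc _
  filter_upwards [ae_all_iff.2 key] with x hx
  have hlim := tendsto_one_div_add_atTop_nhds_zero_nat (𝕜 := ℝ)
  constructor
  · exact le_of_tendsto' (by simpa using hlim.neg) fun n => (hx n).1
  · exact ge_of_tendsto' (by simpa using hlim.const_add 1) fun n => (hx n).2

/-- With `G` the resolvent, symmetry gives `∫_V G1_U = ∫_U G1_V ≤ m(U)`, uniformly in `V`. -/
theorem integrable_resolvent_indicator (hE : IsMarkovian E) {U : Set X} (hU : MeasurableSet U)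
    (hU' : m U ≠ ∞) :
    Integrable (incl E (resolvent E (indicatorConstLp 2 hU hU' 1))) m := by
  refine integrable_of_setIntegral_le _ ?_ (C := m.real U) fun V hV hV' => ?_
  · filter_upwards [resolvent_indicator_mem_Icc hE hU hU'] with x hx using hx.1
  · rw [← L2.inner_indicatorConstLp_one (𝕜 := ℝ) hV hV'.ne, ← inner_resolvent, real_inner_comm,
      inner_resolvent, L2.inner_indicatorConstLp_one]
    have h1 : ∫ x in U, incl E (resolvent E (indicatorConstLp 2 hV hV'.ne 1)) x ∂m ≤
        ∫ _ in U, (1 : ℝ) ∂m := by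
      refine integral_mono_ae (integrableOn_Lp_of_measure_ne_top _ one_le_two hU')
        (integrableOn_const hU') (ae_restrict_of_ae ?_)
      filter_upwards [resolvent_indicator_mem_Icc hE hV hV'.ne] with x hx using hx.2
    simpa using h1

end Resolvent

/-- The vectors `g` such that `E(·, g)` is given by integration against an integrable function. -/
def integrableGenerator (E : QForm (Lp ℝ 2 m)) : Submodule ℝ (FormDomain E) where
  carrier := {g | ∃ φ : Lp ℝ 2 m, Integrable φ m ∧ ∀ v, form v g = ⟪incl E v, φ⟫}
  add_mem' := by
    rintro g g' ⟨φ, hφ, h⟩ ⟨φ', hφ', h'⟩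
    exact ⟨φ + φ', (hφ.add hφ').congr (Lp.coeFn_add _ _).symm, fun v => by
      rw [map_add, h, h', inner_add_right]⟩
  zero_mem' := ⟨0, (integrable_zero _ _ _).congr (Lp.coeFn_zero _ _ _).symm, fun v => by simp⟩
  smul_mem' := by
    rintro c g ⟨φ, hφ, h⟩
    exact ⟨c • φ, (hφ.smul c).congr (Lp.coeFn_smul _ _).symm, fun v => by
      rw [map_smul, h, inner_smul_right, smul_eq_mul]⟩

/-- The resolvent `G1_U` belongs to the space with `φ = 1_U - G1_U`. A vector orthogonal to all of
these has zero integral over every set of finite measure, so it vanishes. -/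
theorem topologicalClosure_integrableGenerator [CompleteSpace (FormDomain E)]
    (hE : IsMarkovian E) : (integrableGenerator E).topologicalClosure = ⊤ := by
  rw [Submodule.topologicalClosure_eq_top_iff, Submodule.eq_bot_iff]
  intro v hv
  have hmem : ∀ U (hU : MeasurableSet U) (hU' : m U ≠ ∞),
      resolvent E (indicatorConstLp 2 hU hU' 1) ∈ integrableGenerator E := by
    intro U hU hU'
    refine ⟨indicatorConstLp 2 hU hU' 1 - incl E (resolvent E (indicatorConstLp 2 hU hU' 1)),
      ?_, fun w => ?_⟩
    · refine Integrable.congr ?_ (Lp.coeFn_sub _ _).symm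
      refine Integrable.sub ?_ (integrable_resolvent_indicator hE hU hU')
      exact ((integrable_indicator_iff hU).2 (integrableOn_const hU')).congr
        indicatorConstLp_coeFn.symm
    · have h := inner_eq w (resolvent E (indicatorConstLp 2 hU hU' 1))
      rw [real_inner_comm, inner_resolvent] at h
      rw [inner_sub_right, real_inner_comm]
      linarith
  refine incl_injective ?_
  rw [map_zero, Lp.eq_zero_iff_ae_eq_zero]
  refine Lp.ae_eq_zero_of_forall_setIntegral_eq_zero _ (by simp) (by simp)
    (fun s _ hs => integrableOn_Lp_of_measure_ne_top _ one_le_two hs.ne) fun s hs hs' => ?_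
  rw [← L2.inner_indicatorConstLp_one (𝕜 := ℝ) hs hs'.ne, ← inner_resolvent]
  exact hv _ (hmem s hs hs'.ne)

end FormDomain

end FormDomain

/-! ### Two-sided truncations built from cutoffs -/

section Truncation

/-- The odd truncation at height `k` built from a cutoff. -/
noncomputable def truncation (C : ℝ → ℝ) (k t : ℝ) : ℝ := k * C (k⁻¹ * t) - k * C (-(k⁻¹ * t))

theorem truncation_neg (C : ℝ → ℝ) (k t : ℝ) : truncation C k (-t) = -truncation C k t := by
  simp only [truncation, mul_neg, neg_neg, neg_sub]

namespace IsCutoff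

variable {ε k : ℝ} {C : ℝ → ℝ}

theorem abs_sub_le (hC : IsCutoff ε C) (s t : ℝ) : |C s - C t| ≤ |s - t| := by
  simpa [Real.dist_eq] using hC.lipschitz.dist_le_mul s t

theorem continuous_truncation (hC : IsCutoff ε C) : Continuous (truncation C k) := by
  have := hC.lipschitz.continuous
  unfold truncation
  fun_prop

theorem abs_truncation_sub_le (hC : IsCutoff ε C) (hk : 0 < k) (s t : ℝ) :
    |truncation C k s - truncation C k t| ≤ 2 * |s - t| := by
  have h1 := hC.abs_sub_le (k⁻¹ * s) (k⁻¹ * t)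
  have h2 := hC.abs_sub_le (-(k⁻¹ * t)) (-(k⁻¹ * s))
  rw [← mul_sub, abs_mul, abs_of_pos (inv_pos.2 hk)] at h1
  rw [neg_sub_neg, ← mul_sub, abs_mul, abs_of_pos (inv_pos.2 hk)] at h2
  have e : truncation C k s - truncation C k t =
      k * ((C (k⁻¹ * s) - C (k⁻¹ * t)) + (C (-(k⁻¹ * t)) - C (-(k⁻¹ * s)))) := by
    simp only [truncation]
    ring
  rw [e, abs_mul, abs_of_pos hk]
  refine (mul_le_mul_of_nonneg_left ((abs_add_le _ _).trans (add_le_add h1 h2)) hk.le).trans ?_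
  rw [mul_add, mul_inv_cancel_left₀ hk.ne']
  linarith

theorem truncation_zero : truncation C k 0 = 0 := by
  simp [truncation]

theorem abs_truncation_le (hC : IsCutoff ε C) (hk : 0 < k) (t : ℝ) :
    |truncation C k t| ≤ 2 * |t| := by
  simpa [truncation_zero] using hC.abs_truncation_sub_le hk t 0

theorem abs_truncation_le_const (hC : IsCutoff ε C) (hk : 0 < k) (t : ℝ) :
    |truncation C k t| ≤ k * (1 + 2 * ε) := by
  rw [truncation, ← mul_sub, abs_mul, abs_of_pos hk]
  refine mul_le_mul_of_nonneg_left ?_ hk.le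
  have h1 := hC.mem_Icc (k⁻¹ * t)
  have h2 := hC.mem_Icc (-(k⁻¹ * t))
  rw [abs_le]
  constructor <;> linarith [h1.1, h1.2, h2.1, h2.2]

/-- For `0 ≤ t ≤ k` the first term of the truncation is exactly `t`, and the reflected one lies in
`[-kε, 0]` before subtraction. Oddness covers negative `t`. -/
theorem abs_truncation_sub_self_le (hC : IsCutoff ε C) (hk : 0 < k) {t : ℝ} (ht : |t| ≤ k) :
    |truncation C k t - t| ≤ k * ε := by
  wlog h0 : 0 ≤ t generalizing t
  · have := this (t := -t) (by rwa [abs_neg]) (by linarith)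
    rwa [truncation_neg, ← neg_sub', abs_neg] at this
  have h1 : C (k⁻¹ * t) = k⁻¹ * t := by
    refine hC.eq_self _ ⟨by positivity, ?_⟩
    rw [inv_mul_le_one₀ hk]
    exact (le_abs_self t).trans ht
  have h2 : C (-(k⁻¹ * t)) ≤ 0 := by
    rw [← hC.map_zero]
    exact hC.monotone (neg_nonpos.2 (by positivity))
  rw [truncation, h1, mul_inv_cancel_left₀ hk.ne', sub_sub_cancel_left, abs_neg, abs_mul,
    abs_of_pos hk, abs_of_nonpos h2]
  exact mul_le_mul_of_nonneg_left (by linarith [(hC.mem_Icc (-(k⁻¹ * t))).1]) hk.le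

end IsCutoff

end Truncation

/-! ### Lower semicontinuity up to a constant, and the closability criterion -/

section Closability

variable {X : Type*} [MeasurableSpace X] {m : Measure X} {E : QForm (Lp ℝ 2 m)}

namespace FormDomain

/-- Forms that are reduced by a cutoff are controlled along the associated truncations. -/
theorem exists_truncation {ε k : ℝ} {C : ℝ → ℝ} (hC : IsCutoff ε C)
    (hCE : ∀ u : Lp ℝ 2 m, E (hC.lipschitz.compLp hC.map_zero u) ≤ E u) (hk : 0 < k)
    (u : FormDomain E) :
    ∃ v : FormDomain E, incl E v =ᵐ[m] (fun x => truncation C k (incl E u x)) ∧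
      energy v ≤ 4 * energy u := by
  set a : Lp ℝ 2 m := hC.lipschitz.compLp hC.map_zero (k⁻¹ • incl E u) with ha
  set b : Lp ℝ 2 m := hC.lipschitz.compLp hC.map_zero (-(k⁻¹ • incl E u)) with hb
  have hscale : ENNReal.ofReal (k ^ 2) * E (k⁻¹ • incl E u) = E (incl E u) := by
    rw [← E.map_smul, smul_inv_smul₀ hk.ne']
  have hEa : E (k • a) ≤ E (incl E u) := by
    rw [E.map_smul, ← hscale]
    gcongr
    exact hCE _
  have hEb : E (k • b) ≤ E (incl E u) := by
    rw [E.map_smul, ← hscale, ← E.map_neg (k⁻¹ • incl E u)]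
    gcongr
    exact hCE _
  -- The constant 4 arises here: the truncation is a difference of two contractions of `±u`,
  -- estimated by the parallelogram identity.
  have hle : E (k • a - k • b) ≤ 4 * E (incl E u) := by
    refine (E.map_sub_le _ _).trans ?_
    calc 2 * E (k • a) + 2 * E (k • b) ≤ 2 * E (incl E u) + 2 * E (incl E u) := by gcongr
      _ = 4 * E (incl E u) := by ring
  have hfin : 4 * E (incl E u) < ∞ := ENNReal.mul_lt_top (by simp) (map_incl_lt_top u)
  refine ⟨⟨k • a - k • b, hle.trans_lt hfin⟩, ?_, ?_⟩
  · change (k • a - k • b : Lp ℝ 2 m) =ᵐ[m] _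
    filter_upwards [Lp.coeFn_sub (k • a) (k • b), Lp.coeFn_smul k a, Lp.coeFn_smul k b,
      hC.lipschitz.coeFn_compLp hC.map_zero (k⁻¹ • incl E u),
      hC.lipschitz.coeFn_compLp hC.map_zero (-(k⁻¹ • incl E u)),
      Lp.coeFn_smul k⁻¹ (incl E u), Lp.coeFn_neg (k⁻¹ • incl E u)] with x h1 h2 h3 h4 h5 h6 h7
    rw [h1, Pi.sub_apply, h2, h3, Pi.smul_apply, Pi.smul_apply, h4, h5, Function.comp_apply,
      Function.comp_apply, h7, Pi.neg_apply, h6]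
    rfl
  · have := ENNReal.toReal_mono hfin.ne hle
    rwa [ENNReal.toReal_mul] at this

theorem inner_incl_eq_integral (u φ : Lp ℝ 2 m) : ⟪u, φ⟫ = ∫ x, u x * φ x ∂m := by
  rw [L2.inner_def]
  refine integral_congr_ae (Eventually.of_forall fun x => ?_)
  exact mul_comm _ _

/-- At a fixed height, Cauchy–Schwarz bounds the truncations of `w i` paired with `g`. The bound
passes to the limit in `i` because `φ` is integrable, and then the height tends to infinity. -/
theorem abs_form_le_of_mem_integrableGenerator (hE : IsMarkovian E) {α : Type*} {l : Filter α}
    [l.NeBot] {w : α → FormDomain E} {w₀ : FormDomain E} {c : ℝ}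
    (hw : ∀ᶠ i in l, energy (w i) ≤ c)
    (hl : ∀ U : Set X, MeasurableSet U → m U < ∞ →
      Tendsto (fun i => localDist m U (incl E (w i) : X →ₘ[m] ℝ) (incl E w₀ : X →ₘ[m] ℝ)) l (𝓝 0))
    {g : FormDomain E} (hg : g ∈ integrableGenerator E) :
    |form w₀ g| ≤ √(4 * c) * √(energy g) := by
  obtain ⟨φ, hφ, hφg⟩ := hg
  have hφm : Measurable φ := (Lp.stronglyMeasurable φ).measurable
  have hpos : ∀ n : ℕ, (0 : ℝ) < n + 1 := fun n => by positivity
  -- With `ε = (n + 1)⁻²` at height `n + 1`, the truncation error is at most `1/(n + 1)`.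
  have hcut : ∀ n : ℕ, ∃ (C : ℝ → ℝ) (hC : IsCutoff ((1 / (n + 1 : ℝ)) ^ 2) C),
      ∀ u : Lp ℝ 2 m, E (hC.lipschitz.compLp hC.map_zero u) ≤ E u := fun n =>
    hE _ (pow_pos (one_div_pos.2 (hpos n)) 2)
  choose C hC hCE using hcut
  have hbound : ∀ n : ℕ, |∫ x, truncation (C n) (n + 1) (incl E w₀ x) * φ x ∂m| ≤
      √(4 * c) * √(energy g) := by
    intro n
    have hlim := tendsto_integral_comp_mul hl hφm hφ (hC n).continuous_truncation
      ((hC n).abs_truncation_sub_le (hpos n)) ((hC n).abs_truncation_le_const (hpos n))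
    refine le_of_tendsto hlim.abs ?_
    filter_upwards [hw] with i hi
    obtain ⟨v, hv, hve⟩ := exists_truncation (hC n) (hCE n) (hpos n) (w i)
    have hint : ∫ x, truncation (C n) (n + 1) (incl E (w i) x) * φ x ∂m = form v g := by
      rw [hφg, inner_incl_eq_integral]
      refine integral_congr_ae ?_
      filter_upwards [hv] with x hx
      rw [hx]
    rw [hint]
    refine (abs_form_le v g).trans (mul_le_mul_of_nonneg_right ?_ (Real.sqrt_nonneg _))
    exact Real.sqrt_le_sqrt (by linarith)
  have hlim : Tendsto (fun n : ℕ => ∫ x, truncation (C n) (n + 1) (incl E w₀ x) * φ x ∂m) atTop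
      (𝓝 (form w₀ g)) := by
    rw [hφg, inner_incl_eq_integral]
    have hprod : Integrable (fun x => incl E w₀ x * φ x) m :=
      (L2.integrable_inner (𝕜 := ℝ) (incl E w₀) φ).congr
        (Eventually.of_forall fun x => mul_comm _ _)
    have hm₀ : Measurable (incl E w₀) := (Lp.stronglyMeasurable _).measurable
    refine tendsto_integral_of_dominated_convergence (fun x => 2 * |incl E w₀ x * φ x|)
      (fun n => (((hC n).continuous_truncation.measurable.comp hm₀).mul hφm).aestronglyMeasurable)
      (hprod.abs.const_mul 2) (fun n => Eventually.of_forall fun x => ?_)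
      (Eventually.of_forall fun x => Tendsto.mul_const _ ?_)
    · rw [norm_mul, Real.norm_eq_abs, Real.norm_eq_abs, abs_mul, ← mul_assoc]
      exact mul_le_mul_of_nonneg_right ((hC n).abs_truncation_le (hpos n) _) (abs_nonneg _)
    · rw [tendsto_iff_dist_tendsto_zero]
      refine squeeze_zero' (Eventually.of_forall fun _ => dist_nonneg) ?_
        (tendsto_one_div_add_atTop_nhds_zero_nat (𝕜 := ℝ))
      filter_upwards [tendsto_natCast_atTop_atTop.eventually_ge_atTop |incl E w₀ x|] with n hn
      rw [Real.dist_eq]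
      refine ((hC n).abs_truncation_sub_self_le (hpos n) (by linarith)).trans_eq ?_
      have := (hpos n).ne'
      field_simp
  exact le_of_tendsto' hlim.abs hbound

/-- Up to a constant, Dirichlet forms are lower semicontinuous on their domain with respect to
local convergence in measure. -/
theorem energy_le_of_tendsto [CompleteSpace (FormDomain E)] (hE : IsMarkovian E) {α : Type*}
    {l : Filter α} [l.NeBot] {w : α → FormDomain E} {w₀ : FormDomain E} {c : ℝ}
    (hw : ∀ᶠ i in l, energy (w i) ≤ c)
    (hl : ∀ U : Set X, MeasurableSet U → m U < ∞ →
      Tendsto (fun i => localDist m U (incl E (w i) : X →ₘ[m] ℝ) (incl E w₀ : X →ₘ[m] ℝ)) l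
        (𝓝 0)) :
    energy w₀ ≤ 4 * c := by
  have hc1 : Continuous fun g : FormDomain E => |form w₀ g| := by
    have h : ∀ g, form w₀ g = ⟪w₀, g⟫ - ⟪incl E w₀, inclL E g⟫ := fun g => by
      rw [inner_eq, inclL_apply, add_sub_cancel_right]
    simp only [h]
    fun_prop
  have hc2 : Continuous fun g : FormDomain E => √(4 * c) * √(energy g) := by
    have h : ∀ g : FormDomain E, energy g = ‖g‖ ^ 2 - ‖inclL E g‖ ^ 2 := fun g => by
      rw [norm_sq_eq, inclL_apply, add_sub_cancel_right]
    simp only [h]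
    fun_prop
  have hmem : w₀ ∈ closure (integrableGenerator E : Set (FormDomain E)) := by
    rw [← Submodule.topologicalClosure_coe, topologicalClosure_integrableGenerator hE]
    trivial
  -- Both sides are continuous in `g` for the form norm, so the bound extends from the dense
  -- subspace to `g = w₀`.
  have hle : |form w₀ w₀| ≤ √(4 * c) * √(energy w₀) :=
    closure_minimal (t := {g | |form w₀ g| ≤ √(4 * c) * √(energy g)})
      (fun g hg => abs_form_le_of_mem_integrableGenerator hE hw hl hg)
      (isClosed_le hc1 hc2) hmem
  rw [form_self, abs_of_nonneg (energy_nonneg _)] at hle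
  obtain ⟨i, hi⟩ := hw.exists
  have hc : 0 ≤ 4 * c := by linarith [energy_nonneg (w i)]
  have h1 := Real.sq_sqrt (energy_nonneg w₀)
  have h2 := Real.sq_sqrt hc
  nlinarith [sq_nonneg (√(4 * c) - √(energy w₀))]

end FormDomain

open FormDomain

theorem onL0_coe (u : Lp ℝ 2 m) : onL0 E (u : X →ₘ[m] ℝ) = E u :=
  dif_pos u.2

theorem onL0_of_notMem {f : X →ₘ[m] ℝ} (hf : f ∉ Lp ℝ 2 m) : onL0 E f = ∞ :=
  dif_neg hf

theorem exists_incl_eq {f : X →ₘ[m] ℝ} (hf : onL0 E f < ∞) :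
    ∃ u : FormDomain E, (incl E u : X →ₘ[m] ℝ) = f := by
  by_cases h : f ∈ Lp ℝ 2 m
  · have h1 := onL0_coe (E := E) ⟨f, h⟩
    exact ⟨⟨⟨f, h⟩, h1.symm.trans_lt hf⟩, rfl⟩
  · exact (hf.ne (onL0_of_notMem h)).elim

/-- The closability criterion: Dirichlet forms vanish along form-Cauchy filters that converge to
zero locally in measure. -/
theorem IsDirichletForm.tendsto_zero (hE : IsDirichletForm E) {F : Filter (X →ₘ[m] ℝ)}
    (hF : (onL0 E).IsApproximation (localMeasureTopology m) 0 F) :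
    Tendsto (onL0 E) F (𝓝 0) := by
  have := completeSpace hE.1
  have := hF.neBot
  rw [ENNReal.tendsto_nhds_zero]
  intro δ hδ
  obtain ⟨ε, hε, hεδ⟩ : ∃ ε : ℝ, 0 < ε ∧ ENNReal.ofReal (4 * ε) ≤ δ := by
    rcases eq_or_ne δ ∞ with rfl | hδ'
    · exact ⟨1, one_pos, le_top⟩
    · refine ⟨δ.toReal / 4, by have := ENNReal.toReal_pos hδ.ne' hδ'; positivity, ?_⟩
      rw [mul_div_cancel₀ _ (by norm_num), ENNReal.ofReal_toReal hδ']
  have hev := (ENNReal.tendsto_nhds_zero.1 hF.cauchy (ENNReal.ofReal ε)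
    (ENNReal.ofReal_pos.2 hε)).curry
  filter_upwards [hev, hF.domain_mem] with f hf hfd
  obtain ⟨w₀, rfl⟩ := exists_incl_eq hfd
  let ι : FormDomain E → (X →ₘ[m] ℝ) := fun u => (incl E u : X →ₘ[m] ℝ)
  have : (comap ι F).NeBot := by
    refine comap_neBot_iff.2 fun t ht => ?_
    obtain ⟨g, hg1, hg2⟩ := F.nonempty_of_mem (inter_mem ht hF.domain_mem)
    obtain ⟨u, rfl⟩ := exists_incl_eq hg2
    exact ⟨u, hg1⟩
  have hι : Tendsto ι (comap ι F) F := tendsto_comap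
  have hsub : ∀ u : FormDomain E, ι (w₀ - u) = ι w₀ - ι u := fun u => rfl
  have hle : energy w₀ ≤ 4 * ε := by
    -- As `u → 0` locally in measure, `w₀ - u → w₀`, while the Cauchy property keeps the energy of
    -- `w₀ - u` below `ε`.
    refine energy_le_of_tendsto hE.2 (l := comap ι F) (w := fun u => w₀ - u) ?_ ?_
    · filter_upwards [hι.eventually hf] with u hu
      refine ENNReal.toReal_le_of_le_ofReal hε.le ?_
      rw [← onL0_coe]
      exact hu
    · intro U hU hU'
      have h1 := (le_nhds_localMeasureTopology 0 F).1 hF.tendsto U hU hU'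
      refine (h1.comp hι).congr fun u => ?_
      change localDist m U (ι u) 0 = localDist m U (ι (w₀ - u)) (ι w₀)
      rw [hsub, ← localDist_sub_zero U (ι w₀ - ι u), sub_sub_cancel_left,
        localDist_comm, ← localDist_sub_zero, zero_sub]
  rw [onL0_coe, ← ofReal_energy]
  exact (ENNReal.ofReal_le_ofReal hle).trans hεδ

end Closability

end FormTheory

theorem mainTheorem12 {X : Type*} [MeasurableSpace X] (m : Measure X) (hm : IsLocalizable m)
    (E : QForm (Lp ℝ 2 m)) (hE : IsDirichletForm E) :
    (onL0 E).IsClosable (localMeasureTopology m) ∧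
      (∃! Ee : QForm (X →ₘ[m] ℝ), IsExtendedForm E Ee) ∧
      ∀ Ee : QForm (X →ₘ[m] ℝ), IsExtendedForm E Ee →
        Ee.IsClosedForm (localMeasureTopology m) ∧
        (onL0 E).IsExtension Ee ∧
        ∀ q : QForm (X →ₘ[m] ℝ), q.IsClosedForm (localMeasureTopology m) →
          (onL0 E).IsExtension q → Ee.IsExtension q := by
  let _ := localMeasureTopology m
  have := isTopologicalAddGroup_localMeasureTopology m
  have := continuousConstSMul_localMeasureTopology m
  have := t2Space_localMeasureTopology hm.1
  have hcomplete := isCompleteVectorTopology_localMeasureTopology hm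
  obtain ⟨Ee, hEe⟩ := QForm.exists_isClosureOf (q := onL0 E) fun F hF => hE.tendsto_zero hF
  exact ⟨⟨Ee, hEe.isExtension, hEe.isClosedForm hcomplete⟩,
    ⟨Ee, hEe, fun E' hE' => QForm.IsClosureOf.unique hE' hEe⟩,
    fun E' hE' => ⟨QForm.IsClosureOf.isClosedForm hcomplete hE', QForm.IsClosureOf.isExtension hE',
      fun q hq hext => QForm.IsClosureOf.isExtension_of_isClosedForm hE' hq hext⟩⟩
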